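/- Let $n\in\mathbb N$ and let $F:\mathbb R^n\to\mathbb R^n$ be a $C^1$ map for which there is a constant $C>0$ with $$|F'(\xi_1)-F'(\xi_2)|\le C\,(|\xi_1|+|\xi_2|)\,|\xi_1-\xi_2|\qquad\text{for all }\xi_1,\xi_2\in\mathbb R^n .$$ Consider the equation $$\partial_t u+(-\Delta)^2u=\nabla\cdot F(\nabla u)\quad\text{on }\mathbb R^n\times(0,T). \tag{1}$$ *Notation.* Let $b(x,t)=t^{-n/4}g(t^{-1/4}x)$ with $g(x)=(2\pi)^{-n}\int_{\mathbb R^n}e^{ix\cdot\xi-|\xi|^4}\,d\xi$ be the biharmonic heat kernel, and $S(t)a=e^{-t\Delta^2}a=\int_{\mathbb R^n} b(\cdot-y,t)\,a(y)\,dy$ for $t>0$. $\mathrm{BMO}$ is the space of $a\in L^1_{\rm loc}(\mathbb R^n)$ with $\sup_{x\in\mathbb R^n,\,r>0}\frac1{|B(x,r)|}\int_{B(x,r)}|a(y)-a_{x,r}|\,dy<\infty$, where $a_{x,r}=\frac1{|B(x,r)|}\int_{B(x,r)}a(y)\,dy$. For $T\in(0,\infty)$, $X_T$ is the space of measurable $u:\mathbb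 R^n\times[0,T]\to\mathbb R$ having weak spatial derivatives $\nabla u(\cdot,t)$, $\nabla^2u(\cdot,t)$ for $0<t\le T$ (jointly measurable in $(x,t)$), such that $$\|u\|_{X_T}=\sum_{k=1}^2\Big[\sup_{0<t\le T}t^{k/4}\|\nabla^ku(\cdot,t)\|_{L^\infty(\mathbb R^n)}+\sup_{x\in\mathbb R^n,\;0<r\le T^{1/4}}\Big(\int_0^{r^4}\frac1{|B(x,r)|}\int_{B(x,r)}|\nabla^ku(y,t)|^{4/k}\,dy\,dt\Big)^{k/4}\Big]<\infty ,$$ and $X_{0,T}$ is the subspace of those $u\in X_T$ with $\lim_{t\searrow0}\|u\|_{X_t}=0$. Functions in $\mathrm{BMO}$ and in $X_T$ that differ only by a constant are identified. A mild solution of (1) with initial data $u_0$ is a function $u$ with $u(0)=u_0$ and $$u(t)=S(t)u_0+\int_0^tS(t-s)\,\nabla\cdot F(\nabla u(s))\,ds\quad\text{a.e. on }\mathbb R^n,\qquad 0<t\le T .$$ **Proposition.** Let $T>0$ and let $u,v\in X_{0,T}$ be mild solutions of (1) with the same initial data $u_0\in\mathrm{BMO}$. Then $u$ and $v$ coincide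 in $X_{0,T}$. Precisely: if $u_0\in\mathrm{BMO}$, $u_0-v_0=c$ a.e. for a constant $c\in\mathbb R$, and $u,v\in X_{0,T}$ are mild solutions of (1) with initial data $u_0$ and $v_0$, respectively, then $u(\cdot,t)-v(\cdot,t)=c$ a.e. on $\mathbb R^n$ for every $t\in[0,T]$, and $\|u-v\|_{X_T}=0$. (In particular $u(\cdot,t)=v(\cdot,t)$ a.e. for every $t$ if $u_0=v_0$.) -/

import Mathlib

open MeasureTheory Set Filter Topology
open scoped ENNReal ContDiff

noncomputable section

namespace BiharmonicBMO

/-- The Euclidean space `ℝⁿ`. -/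
abbrev Rn (n : ℕ) : Type := EuclideanSpace ℝ (Fin n)

/-- The profile `g(x) = (2π)⁻ⁿ ∫ exp(i x·ξ - |ξ|⁴) dξ` of the biharmonic heat kernel
(the integral is real, so taking the real part only changes the type). -/
def heatProfile {n : ℕ} (x : Rn n) : ℝ :=
  ((2 * Real.pi) ^ n)⁻¹ *
    (∫ ξ : Rn n, Complex.exp (Complex.I * ((inner ℝ x ξ : ℝ) : ℂ) - ((‖ξ‖ ^ 4 : ℝ) : ℂ))).re

/-- The biharmonic heat kernel `b(x,t) = t^(-n/4) g(x / t^(1/4))`, for `t > 0`. -/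
def heatKernel {n : ℕ} (t : ℝ) (x : Rn n) : ℝ :=
  t ^ (-(n : ℝ) / 4) * heatProfile ((t ^ (-(1 : ℝ) / 4)) • x)

/-- The semigroup `S(t) a = e^{-tΔ²} a = b(·,t) * a`, for `t > 0`. -/
def semigroup {n : ℕ} (t : ℝ) (a : Rn n → ℝ) (x : Rn n) : ℝ :=
  ∫ y, heatKernel t (x - y) * a y

/-- Functions of bounded mean oscillation on `ℝⁿ`. -/
def MemBMO {n : ℕ} (a : Rn n → ℝ) : Prop :=
  LocallyIntegrable a ∧
    ∃ M : ℝ, ∀ (x : Rn n) (r : ℝ), 0 < r →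
      ⨍ y in Metric.ball x r, |a y - ⨍ z in Metric.ball x r, a z| ≤ M

/-- `f'` is the weak (distributional) derivative of `f` on `ℝⁿ`. -/
def HasWeakFDeriv {n : ℕ} {G : Type*} [NormedAddCommGroup G] [NormedSpace ℝ G]
    (f : Rn n → G) (f' : Rn n → Rn n →L[ℝ] G) : Prop :=
  LocallyIntegrable f ∧ LocallyIntegrable f' ∧
    ∀ φ : Rn n → ℝ, ContDiff ℝ ∞ φ → HasCompactSupport φ → ∀ e : Rn n,
      ∫ x, (fderiv ℝ φ x e) • f x = - ∫ x, φ x • f' x e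

/-- `Du` and `D2u` are (jointly measurable versions of) the weak spatial gradient `∇u` and the weak
spatial Hessian `∇²u` of the measurable function `u`, at all times `t ∈ (0,T]`. -/
structure IsWeakJet {n : ℕ} (T : ℝ) (u : ℝ → Rn n → ℝ)
    (Du : ℝ → Rn n → Rn n) (D2u : ℝ → Rn n → Rn n →L[ℝ] Rn n) : Prop where
  aesm : AEStronglyMeasurable (fun p : ℝ × Rn n => u p.1 p.2)
    ((volume.restrict (Ioc 0 T)).prod volume)
  aesm_grad : AEStronglyMeasurable (fun p : ℝ × Rn n => Du p.1 p.2)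
    ((volume.restrict (Ioc 0 T)).prod volume)
  aesm_hess : AEStronglyMeasurable (fun p : ℝ × Rn n => D2u p.1 p.2)
    ((volume.restrict (Ioc 0 T)).prod volume)
  weak_grad : ∀ t ∈ Ioc 0 T, HasWeakFDeriv (u t) (fun x => innerSL ℝ (Du t x))
  weak_hess : ∀ t ∈ Ioc 0 T, HasWeakFDeriv (Du t) (D2u t)

/-- `sup_{0 < t ≤ T} t^(k/4) ‖D(·,t)‖_{L^∞}`, to be used with `D = ∇ᵏu`. -/
def Ninfty {n : ℕ} {G : Type*} [NormedAddCommGroup G] (k : ℕ) (T : ℝ) (D : ℝ → Rn n → G) : ℝ≥0∞ :=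
  ⨆ t ∈ Ioc (0 : ℝ) T, ENNReal.ofReal (t ^ ((k : ℝ) / 4)) * eLpNorm (D t) ⊤ volume

/-- `sup_{x, 0 < r ≤ T^(1/4)} (∫_0^{r⁴} ⨍_{B(x,r)} |D(y,t)|^(4/k) dy dt)^(k/4)`,
to be used with `D = ∇ᵏu`. -/
def Ncarleson {n : ℕ} {G : Type*} [NormedAddCommGroup G] (k : ℕ) (T : ℝ) (D : ℝ → Rn n → G) :
    ℝ≥0∞ :=
  ⨆ (x : Rn n), ⨆ r ∈ Ioc (0 : ℝ) (T ^ ((1 : ℝ) / 4)),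
    (∫⁻ t in Ioc 0 (r ^ 4), ⨍⁻ y in Metric.ball x r, ‖D t y‖ₑ ^ ((4 : ℝ) / k) ∂volume) ^ ((k : ℝ) / 4)

/-- The (semi-)norm `‖u‖_{X_T}`. It is `∞` if `u` has no weak spatial derivatives up to order two;
otherwise they are unique up to null sets, and the infimum is over equal numbers. -/
def XNorm {n : ℕ} (T : ℝ) (u : ℝ → Rn n → ℝ) : ℝ≥0∞ :=
  ⨅ (Du : ℝ → Rn n → Rn n) (D2u : ℝ → Rn n → Rn n →L[ℝ] Rn n) (_ : IsWeakJet T u Du D2u),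
    (Ninfty 1 T Du + Ncarleson 1 T Du) + (Ninfty 2 T D2u + Ncarleson 2 T D2u)

/-- The space `X_T`. -/
def MemX {n : ℕ} (T : ℝ) (u : ℝ → Rn n → ℝ) : Prop :=
  XNorm T u < ⊤

/-- The space `X_{0,T}` of the `u ∈ X_T` with `‖u‖_{X_t} → 0` as `t ↘ 0`. -/
def MemX0 {n : ℕ} (T : ℝ) (u : ℝ → Rn n → ℝ) : Prop :=
  MemX T u ∧ Tendsto (fun t => XNorm t u) (𝓝[>] 0) (𝓝 0)

/-- `∇ · F(∇u) = ∑ᵢⱼ ∂ⱼFᵢ(∇u) ∂ᵢ∂ⱼu` at a point where `∇u = p` and `∇²u = H`. -/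
def divFlux {n : ℕ} (F : Rn n → Rn n) (p : Rn n) (H : Rn n →L[ℝ] Rn n) : ℝ :=
  ∑ i, (fderiv ℝ F p (H (EuclideanSpace.single i 1))) i

/-- `u` is a mild solution on `[0,T]` of `∂ₜu + Δ²u = ∇ · F(∇u)`, `u(0) = u₀`, that is
`u(t) = S(t)u₀ + ∫_0^t S(t-s) ∇ · F(∇u(s)) ds`. -/
def IsMildSolution {n : ℕ} (F : Rn n → Rn n) (T : ℝ) (u₀ : Rn n → ℝ) (u : ℝ → Rn n → ℝ) : Prop :=
  u 0 =ᵐ[volume] u₀ ∧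
    ∃ (Du : ℝ → Rn n → Rn n) (D2u : ℝ → Rn n → Rn n →L[ℝ] Rn n),
      IsWeakJet T u Du D2u ∧
      ∀ t ∈ Ioc 0 T, ∀ᵐ x : Rn n,
        u t x = semigroup t u₀ x +
          ∫ s in (0 : ℝ)..t, semigroup (t - s) (fun y => divFlux F (Du s y) (D2u s y)) x

end BiharmonicBMO

end

/-! Two mild solutions with data differing by `c` satisfy `u - v = c + duhamel (F(∇u) - F(∇v))`:
`BMO` data are integrable against the rapidly decaying kernel, so `S(t)u₀ - S(t)v₀ = c`
(`semigroup_sub_semigroup_eq_const`), and the divergence can be moved onto the kernel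
(`semigroup_divFlux_eq`). It therefore suffices to show `∇u = ∇v`, since then the Duhamel term
vanishes.

The kernel is a rescaled Schwartz function, so `∇b(·,t)` is Lipschitz under translation in `L¹` with
constant of order `t^(-1/2)`. Hence (`exists_duhamel_lipschitzWith`) the gradient of the Duhamel
term is bounded by `N ∫₀ᵗ (t-s)^(-1/2) ‖F(∇u(s)) - F(∇v(s))‖_∞ ds`. The condition on `F'` gives
`|F(ξ₁) - F(ξ₂)| ≤ (|F'(0)| + C b²) |ξ₁ - ξ₂|` on the ball of radius `b`.

By membership in `X_{0,T}`, `b = η s^(-1/4)` is admissible for `s ≤ t₀`, with `η` as small as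
desired; the resulting factor `C η² s^(-1/2)` is scale critical, but small. Everything else is a
bounded factor `K'`, hence subcritical, and the weight `exp(μ⁴t)` with `μ` large makes it small on
all of `(0,T]` at once. So any bound `W exp(μ⁴t) t^(-1/4)` for `|∇u - ∇v|` improves to the same
bound with `W/2` (`integral_weight_le`); iteration gives `∇u = ∇v`. -/

noncomputable section

namespace BiharmonicBMO

open scoped SchwartzMap FourierTransform NNReal Convolution

/-! ### The kernel profile as a Schwartz function -/

section Profile

lemma one_add_pow_mul_exp_neg_pow_four_le (N : ℕ) {r : ℝ} (hr : 0 ≤ r) :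
    (1 + r) ^ N * Real.exp (-r ^ 4) ≤ N.factorial * Real.exp 2 := by
  have h1 : (1 + r) ^ N ≤ N.factorial * Real.exp (1 + r) := by
    have := Real.pow_div_factorial_le_exp (1 + r) (by positivity) N
    rwa [div_le_iff₀' (by positivity)] at this
  have h2 : r ≤ 1 + r ^ 4 := by nlinarith [sq_nonneg (r ^ 2 - 1), sq_nonneg (r - 1), sq_nonneg r]
  calc (1 + r) ^ N * Real.exp (-r ^ 4)
      ≤ N.factorial * Real.exp (1 + r) * Real.exp (-r ^ 4) := by gcongr
    _ = N.factorial * Real.exp (1 + r - r ^ 4) := by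
        rw [mul_assoc, ← Real.exp_add]; ring_nf
    _ ≤ N.factorial * Real.exp 2 := by gcongr; linarith

/-- The Schwartz function `ξ ↦ exp (-|ξ|⁴)`. -/
def expNegNormPowFour (n : ℕ) : 𝓢(Rn n, ℝ) where
  toFun ξ := Real.exp (-‖ξ‖ ^ 4)
  smooth' := by
    have : (fun ξ : Rn n => Real.exp (-‖ξ‖ ^ 4)) = fun ξ => Real.exp (-(‖ξ‖ ^ 2) ^ 2) := by
      ext ξ; ring_nf
    rw [this]
    exact Real.contDiff_exp.comp ((contDiff_norm_sq ℝ).pow 2).neg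
  decay' k m := by
    -- Faà di Bruno: every derivative of `exp` is `exp` and the exponent has polynomially bounded
    -- derivatives, so each derivative is a polynomial factor times `exp(-|x|⁴)`.
    have hf : Function.HasTemperateGrowth (fun ξ : Rn n => -‖ξ‖ ^ 4) := by
      have := (Function.hasTemperateGrowth_norm_sq (H := Rn n)).pow 2
      have h2 := this.neg
      convert! h2 using 1
      ext ξ; simp; ring
    obtain ⟨l, C, hC, hgrowth⟩ := hf.norm_iteratedFDeriv_le_uniform m
    refine ⟨m.factorial * (C + 1) ^ m * ((k + l * m).factorial * Real.exp 2), fun x => ?_⟩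
    -- Both `C + 1` and `(1 + ‖x‖)^l` are at least `1`, so for `N ≥ 1` they are dominated by their
    -- `N`-th powers, the form required by the composition bound.
    have hD (N : ℕ) (hN₁ : 1 ≤ N) (hN₂ : N ≤ m) :
        ‖iteratedFDeriv ℝ N (fun ξ : Rn n => -‖ξ‖ ^ 4) x‖ ≤ ((C + 1) * (1 + ‖x‖) ^ l) ^ N := by
      refine (hgrowth N hN₂ x).trans ?_
      rw [mul_pow]
      have hN₁' := (lt_of_lt_of_le zero_lt_one hN₁).ne'
      gcongr
      · exact le_trans (by simp) (le_self_pow₀ (by simp [hC]) hN₁')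
      · refine le_self_pow₀ (one_le_pow₀ ?_) hN₁'
        simp only [le_add_iff_nonneg_right, norm_nonneg]
    have hE (i : ℕ) (_ : i ≤ m) : ‖iteratedFDeriv ℝ i Real.exp (-‖x‖ ^ 4)‖ ≤
        Real.exp (-‖x‖ ^ 4) := by
      rw [norm_iteratedFDeriv_eq_norm_iteratedDeriv, iteratedDeriv_eq_iterate, Real.iter_deriv_exp,
        Real.norm_of_nonneg (Real.exp_pos _).le]
    have := norm_iteratedFDeriv_comp_le (N := ∞) Real.contDiff_exp hf.1 (mod_cast le_top) x hE hD
    have hxk : ‖x‖ ^ k ≤ (1 + ‖x‖) ^ k :=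
      pow_le_pow_left₀ (norm_nonneg _) (by simp only [zero_le_one, le_add_iff_nonneg_left]) _
    calc ‖x‖ ^ k * ‖iteratedFDeriv ℝ m (fun ξ : Rn n => Real.exp (-‖ξ‖ ^ 4)) x‖
        ≤ (1 + ‖x‖) ^ k * (m.factorial * Real.exp (-‖x‖ ^ 4) *
          ((C + 1) * (1 + ‖x‖) ^ l) ^ m) := by
          gcongr
          exact this
      _ = m.factorial * (C + 1) ^ m * ((1 + ‖x‖) ^ (k + l * m) * Real.exp (-‖x‖ ^ 4)) := by
          rw [mul_pow, pow_add, ← pow_mul]; ring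
      _ ≤ _ := by
          exact mul_le_mul_of_nonneg_left
            (one_add_pow_mul_exp_neg_pow_four_le _ (norm_nonneg x)) (by positivity)

/-- The heat profile is a Schwartz function of integral one. -/
theorem exists_schwartzMap_heatProfile (n : ℕ) :
    ∃ G : 𝓢(Rn n, ℝ), (∀ x, G x = heatProfile x) ∧ ∫ x, G x = 1 := by
  set f : 𝓢(Rn n, ℂ) := (expNegNormPowFour n).postcompCLM Complex.ofRealCLM with hf
  have h2pi : (2 * Real.pi) ≠ 0 := by positivity
  -- `𝓕` carries the phase `exp(-2πi x·ξ)`; evaluating it at `-x/(2π)` gives `exp(i x·ξ)`.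
  set A : Rn n ≃L[ℝ] Rn n :=
    ContinuousLinearEquiv.smulLeft (Units.mk0 (-(2 * Real.pi)⁻¹) (by simp)) with hA
  have hAx : ∀ x, A x = (-(2 * Real.pi)⁻¹) • x := fun x => rfl
  set G₁ : 𝓢(Rn n, ℂ) := SchwartzMap.compCLMOfContinuousLinearEquiv ℝ A (𝓕 f) with hG₁
  set G : 𝓢(Rn n, ℝ) := ((2 * Real.pi) ^ n)⁻¹ • G₁.postcompCLM Complex.reCLM with hG
  have hGx : ∀ x, G x = ((2 * Real.pi) ^ n)⁻¹ * ((𝓕 f) ((-(2 * Real.pi)⁻¹) • x)).re := by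
    intro x; rfl
  refine ⟨G, fun x => ?_, ?_⟩
  · rw [hGx, heatProfile, SchwartzMap.fourier_coe, Real.fourier_eq']
    congr 2
    refine congrArg _ (funext fun ξ => ?_)
    have : f ξ = Complex.exp (-((‖ξ‖ ^ 4 : ℝ) : ℂ)) := by
      change ((Real.exp (-‖ξ‖ ^ 4) : ℝ) : ℂ) = _
      push_cast; rfl
    rw [this, smul_eq_mul, ← Complex.exp_add]
    congr 1
    rw [inner_smul_right, real_inner_comm]
    have : -2 * Real.pi * (-(2 * Real.pi)⁻¹ * inner ℝ x ξ) = inner ℝ x ξ := by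
      field_simp
    rw [this]; ring
  · simp_rw [hGx]
    rw [integral_const_mul]
    have hsc := Measure.integral_comp_smul (volume : Measure (Rn n))
      (fun x => ((𝓕 f) x).re) (-(2 * Real.pi)⁻¹)
    -- Fourier inversion at the origin; the Jacobian `(2π)ⁿ` of the dilation later cancels the
    -- prefactor.
    have h0 : ∫ x, (𝓕 f) x = f 0 := by
      have := congrArg (fun h : 𝓢(Rn n, ℂ) => h 0) 
        (FourierTransform.fourierInv_fourier_eq (F := 𝓢(Rn n, ℂ)) f)
      rw [← this, SchwartzMap.fourierInv_coe, Real.fourierInv_eq']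
      simp
    have hf0 : f 0 = 1 := by
      change ((Real.exp (-‖(0 : Rn n)‖ ^ 4) : ℝ) : ℂ) = 1
      simp
    have h1 : ∫ x, ((𝓕 f) x).re = 1 := by
      have := integral_re (𝕜 := ℂ) (𝓕 f).integrable (μ := volume)
      rw [h0, hf0] at this
      simpa using this
    rw [h1] at hsc
    refine (congrArg _ hsc).trans ?_
    simp [abs_of_pos Real.pi_pos, abs_mul, abs_inv, abs_pow, mul_pow]
    field_simp

/-- Schwartz decay in the form used throughout. -/
lemma _root_.SchwartzMap.exists_norm_le_one_add_pow {E F : Type*} [NormedAddCommGroup E]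
    [NormedSpace ℝ E] [NormedAddCommGroup F] [NormedSpace ℝ F] (f : 𝓢(E, F)) (m : ℕ) :
    ∃ C : ℝ, 0 ≤ C ∧ ∀ x, ‖f x‖ ≤ C * ((1 + ‖x‖) ^ m)⁻¹ := by
  refine ⟨2 ^ m * (Finset.Iic (m, 0)).sup (fun m => SchwartzMap.seminorm ℝ m.1 m.2) f,
    by positivity, fun x => ?_⟩
  have := SchwartzMap.one_add_le_sup_seminorm_apply (𝕜 := ℝ) (m := (m, 0)) le_rfl le_rfl f x
  rw [norm_iteratedFDeriv_zero] at this
  rw [← div_eq_mul_inv, le_div_iff₀ (by positivity), mul_comm]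
  exact this

end Profile

/-! ### Polynomial weights -/

section Decay

variable {E : Type*} [NormedAddCommGroup E]

/-- Peetre's inequality `1 + |z| ≤ (1 + |h|)(1 + |z + h|)`; it allows decay to be read off at a
translated point. -/
lemma inv_one_add_norm_add_pow_le (m : ℕ) (z h : E) :
    ((1 + ‖z + h‖) ^ m)⁻¹ ≤ (1 + ‖h‖) ^ m * ((1 + ‖z‖) ^ m)⁻¹ := by
  rw [← div_eq_mul_inv, le_div_iff₀ (by positivity), ← div_eq_inv_mul,
    div_le_iff₀ (by positivity), ← mul_pow]
  gcongr
  have : ‖z‖ ≤ ‖z + h‖ + ‖h‖ := by simpa using norm_sub_le (z + h) h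
  nlinarith [norm_nonneg h, norm_nonneg (z + h), norm_nonneg z]

lemma inv_one_add_norm_sub_pow_le (m : ℕ) (x y : E) :
    ((1 + ‖x - y‖) ^ m)⁻¹ ≤ (1 + ‖x‖) ^ m * ((1 + ‖y‖) ^ m)⁻¹ := by
  have := inv_one_add_norm_add_pow_le m y (-x)
  rwa [norm_neg, ← sub_eq_add_neg, norm_sub_rev] at this

lemma integrable_inv_one_add_norm_pow (n : ℕ) :
    Integrable (fun y : Rn n => ((1 + ‖y‖) ^ (n + 1))⁻¹) := by
  have := integrable_one_add_norm (E := Rn n) (μ := volume) (r := (n + 1 : ℕ)) (by simp)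
  refine this.congr (Eventually.of_forall fun y => ?_)
  simp only
  rw [Real.rpow_neg (by positivity), Real.rpow_natCast]

end Decay

/-! ### Translations of Schwartz functions in `L¹` -/

section Shift

/-- The `L¹` modulus of continuity of a Schwartz function is Lipschitz. -/
lemma _root_.SchwartzMap.exists_integral_norm_sub_shift_le {n : ℕ} {G : Type*}
    [NormedAddCommGroup G] [NormedSpace ℝ G] (f : 𝓢(Rn n, G)) :
    ∃ N : ℝ, 0 ≤ N ∧ ∀ h : Rn n, ∫ z, ‖f (z + h) - f z‖ ≤ N * ‖h‖ := by
  obtain ⟨C, hC, hf'⟩ := (SchwartzMap.fderivCLM ℝ (Rn n) G f).exists_norm_le_one_add_pow (n + 1)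
  set J := ∫ y : Rn n, ((1 + ‖y‖) ^ (n + 1))⁻¹
  have hJ : 0 ≤ J := integral_nonneg fun y => by positivity
  have hI : 0 ≤ ∫ z, ‖f z‖ := integral_nonneg fun y => norm_nonneg _
  refine ⟨C * 2 ^ (n + 1) * J + 2 * ∫ z, ‖f z‖, by positivity, fun h => ?_⟩
  have hf : Integrable (fun z => f z) := f.integrable
  have hint : Integrable (fun z => f (z + h)) := hf.comp_add_right h
  have hdiff : Integrable (fun z => ‖f (z + h) - f z‖) := (hint.sub hf).norm
  -- Small shifts: mean value theorem, the decay of the derivative being comparable along the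
  -- segment. Large shifts: the norm is at most `2‖f‖₁ ≤ 2‖f‖₁|h|`.
  rcases le_or_gt ‖h‖ 1 with hh | hh
  · have hpt : ∀ z, ‖f (z + h) - f z‖ ≤ C * 2 ^ (n + 1) * ‖h‖ * ((1 + ‖z‖) ^ (n + 1))⁻¹ := by
      intro z
      have hd : ∀ w ∈ segment ℝ z (z + h), ‖fderiv ℝ f w‖ ≤
          C * 2 ^ (n + 1) * ((1 + ‖z‖) ^ (n + 1))⁻¹ := by
        intro w hw
        obtain ⟨k, hk⟩ : ∃ k, w = z + k := ⟨w - z, by abel⟩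
        have hkn : ‖k‖ ≤ 1 := by
          have := segment_subset_closedBall_left z (z + h) hw
          simp [hk] at this
          linarith
        refine (hf' w).trans ?_
        rw [hk, mul_assoc]
        refine mul_le_mul_of_nonneg_left ?_ hC
        refine (inv_one_add_norm_add_pow_le (n + 1) z k).trans ?_
        gcongr
        linarith
      have := (convex_segment z (z + h)).norm_image_sub_le_of_norm_fderiv_le (𝕜 := ℝ)
        (fun w _ => f.differentiableAt) hd (left_mem_segment ℝ _ _) (right_mem_segment ℝ _ _)
      rw [add_sub_cancel_left] at this
      linarith
    calc ∫ z, ‖f (z + h) - f z‖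
        ≤ ∫ z : Rn n, C * 2 ^ (n + 1) * ‖h‖ * ((1 + ‖z‖) ^ (n + 1))⁻¹ :=
          integral_mono hdiff
            ((integrable_inv_one_add_norm_pow n).const_mul _) hpt
      _ = C * 2 ^ (n + 1) * J * ‖h‖ := by rw [integral_const_mul]; ring
      _ ≤ _ := by gcongr; linarith
  · have hfn : Integrable (fun z => ‖f z‖) := hf.norm
    have hfs : Integrable (fun z => ‖f (z + h)‖) := hint.norm
    have h1 : ∫ z, ‖f (z + h) - f z‖ ≤ ∫ z, (‖f (z + h)‖ + ‖f z‖) :=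
      integral_mono hdiff (hfs.add hfn) fun z => norm_sub_le _ _
    rw [integral_add hfs hfn, integral_add_right_eq_self (fun z => ‖f z‖)] at h1
    have h2 : (∫ z, ‖f z‖) * 1 ≤ (∫ z, ‖f z‖) * ‖h‖ := by gcongr
    have h3 : 0 ≤ C * 2 ^ (n + 1) * J * ‖h‖ :=
      mul_nonneg (mul_nonneg (mul_nonneg hC (by positivity)) hJ) (norm_nonneg h)
    generalize (∫ z, ‖f z‖) = I at h1 h2 ⊢
    generalize (∫ z, ‖f (z + h) - f z‖) = I' at h1 ⊢
    linarith

end Shift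

/-! ### Scaling of the heat kernel and its gradient -/

section Kernel

variable {n : ℕ}

/-- The heat profile as a Schwartz function. -/
def profile (n : ℕ) : 𝓢(Rn n, ℝ) := (exists_schwartzMap_heatProfile n).choose

lemma profile_apply (x : Rn n) : profile n x = heatProfile x :=
  (exists_schwartzMap_heatProfile n).choose_spec.1 x

lemma integral_profile : ∫ x, profile n x = 1 :=
  (exists_schwartzMap_heatProfile n).choose_spec.2

/-- The derivative of the heat profile as a Schwartz function. -/
def profileDeriv (n : ℕ) : 𝓢(Rn n, Rn n →L[ℝ] ℝ) := SchwartzMap.fderivCLM ℝ (Rn n) ℝ (profile n)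

/-- The inverse parabolic length scale `t ^ (-1/4)`. -/
def invScale (t : ℝ) : ℝ := t ^ (-(1 : ℝ) / 4)

/-- The spatial derivative of the heat kernel. -/
def gradKernel (t : ℝ) (z : Rn n) : Rn n →L[ℝ] ℝ :=
  (invScale t) ^ (n + 1) • profileDeriv n (invScale t • z)

lemma invScale_pos {t : ℝ} (ht : 0 < t) : 0 < invScale t := Real.rpow_pos_of_pos ht _

lemma measurable_invScale : Measurable invScale := by unfold invScale; fun_prop

lemma heatKernel_eq {t : ℝ} (ht : 0 < t) (z : Rn n) :
    heatKernel t z = invScale t ^ n * profile n (invScale t • z) := by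
  rw [heatKernel, profile_apply, invScale, ← Real.rpow_natCast, ← Real.rpow_mul ht.le]
  congr 2
  ring

lemma hasFDerivAt_heatKernel {t : ℝ} (ht : 0 < t) (z : Rn n) :
    HasFDerivAt (heatKernel t) (gradKernel t z) z := by
  have h1 : HasFDerivAt (profile n) (profileDeriv n (invScale t • z)) (invScale t • z) :=
    (profile n).differentiableAt.hasFDerivAt
  have h2 : HasFDerivAt (fun z : Rn n => invScale t • z)
      (invScale t • ContinuousLinearMap.id ℝ (Rn n)) z :=
    (hasFDerivAt_id (𝕜 := ℝ) z).fun_const_smul (invScale t)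
  have h3 := (h1.comp z h2).const_mul (invScale t ^ n)
  have : (heatKernel t : Rn n → ℝ) = fun z => invScale t ^ n * profile n (invScale t • z) :=
    funext fun z => heatKernel_eq ht z
  rw [this]
  convert! h3 using 1
  ext v
  simp [gradKernel]
  ring

/-- The heat kernel at a positive time as a Schwartz function. -/
lemma exists_schwartzMap_heatKernel {t : ℝ} (ht : 0 < t) :
    ∃ K : 𝓢(Rn n, ℝ), (∀ z, K z = heatKernel t z) ∧
      ∀ z, SchwartzMap.fderivCLM ℝ (Rn n) ℝ K z = gradKernel t z := by
  set A : Rn n ≃L[ℝ] Rn n :=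
    ContinuousLinearEquiv.smulLeft (Units.mk0 (invScale t) (invScale_pos ht).ne')
  set K : 𝓢(Rn n, ℝ) :=
    (invScale t ^ n) • SchwartzMap.compCLMOfContinuousLinearEquiv ℝ A (profile n)
  have hK : ∀ z, K z = heatKernel t z := fun z => (heatKernel_eq ht z).symm
  refine ⟨K, hK, fun z => ?_⟩
  rw [SchwartzMap.fderivCLM_apply, show (K : Rn n → ℝ) = heatKernel t from funext hK]
  exact (hasFDerivAt_heatKernel ht z).fderiv

lemma integral_comp_invScale_smul {t : ℝ} (ht : 0 < t) (f : Rn n → ℝ) :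
    ∫ z, f (invScale t • z) = (invScale t ^ n)⁻¹ * ∫ z, f z := by
  have := Measure.integral_comp_smul (volume : Measure (Rn n)) f (invScale t)
  rw [this]
  have := invScale_pos ht
  simp [abs_of_pos this]

lemma integral_heatKernel {t : ℝ} (ht : 0 < t) : ∫ z : Rn n, heatKernel t z = 1 := by
  have := invScale_pos ht
  simp_rw [heatKernel_eq ht]
  rw [integral_const_mul, integral_comp_invScale_smul ht, integral_profile]
  field_simp

lemma integrable_gradKernel {t : ℝ} (ht : 0 < t) :
    Integrable (fun z : Rn n => gradKernel t z) := by
  obtain ⟨K, -, hK⟩ := exists_schwartzMap_heatKernel (n := n) ht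
  exact (SchwartzMap.fderivCLM ℝ (Rn n) ℝ K).integrable.congr (Eventually.of_forall hK)

lemma integral_norm_gradKernel {t : ℝ} (ht : 0 < t) :
    ∫ z : Rn n, ‖gradKernel t z‖ = invScale t * ∫ z, ‖profileDeriv n z‖ := by
  have := invScale_pos ht
  simp_rw [gradKernel, norm_smul, Real.norm_of_nonneg (pow_nonneg this.le _)]
  rw [integral_const_mul, integral_comp_invScale_smul ht (fun z => ‖profileDeriv n z‖), pow_succ]
  field_simp

/-- One factor `t^(-1/4)` comes from the gradient and one from rescaling the shift. This plays the
role of an `L¹` bound for the second derivatives of the kernel. -/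
lemma exists_integral_norm_gradKernel_sub_le (n : ℕ) :
    ∃ N : ℝ, 0 ≤ N ∧ ∀ t : ℝ, 0 < t → ∀ h : Rn n,
      ∫ z, ‖gradKernel t (z + h) - gradKernel t z‖ ≤ N * invScale t ^ 2 * ‖h‖ := by
  obtain ⟨N, hN, H⟩ := (profileDeriv n).exists_integral_norm_sub_shift_le
  refine ⟨N, hN, fun t ht h => ?_⟩
  have := invScale_pos ht
  have hpt : ∀ z : Rn n, ‖gradKernel t (z + h) - gradKernel t z‖ = invScale t ^ (n + 1) *
      ‖profileDeriv n (invScale t • z + invScale t • h) - profileDeriv n (invScale t • z)‖ := by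
    intro z
    rw [gradKernel, gradKernel, smul_add]
    refine (congrArg norm (smul_sub (invScale t ^ (n + 1)) _ _).symm).trans ?_
    rw [norm_smul, Real.norm_of_nonneg (pow_nonneg this.le _)]
  simp_rw [hpt]
  rw [integral_const_mul, integral_comp_invScale_smul ht
    (fun z => ‖profileDeriv n (z + invScale t • h) - profileDeriv n z‖)]
  have H' := H (invScale t • h)
  rw [norm_smul, Real.norm_of_nonneg this.le] at H'
  calc _ = invScale t * ∫ z, ‖profileDeriv n (z + invScale t • h) - profileDeriv n z‖ := by
        rw [pow_succ]; field_simp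
    _ ≤ invScale t * (N * (invScale t * ‖h‖)) := by gcongr
    _ = _ := by ring

lemma measurable_gradKernel_uncurry (t : ℝ) (x : Rn n) :
    Measurable (fun p : ℝ × Rn n => gradKernel (t - p.1) (x - p.2)) := by
  have h1 : Measurable (fun p : ℝ × Rn n => invScale (t - p.1)) :=
    measurable_invScale.comp (by fun_prop)
  unfold gradKernel
  refine (h1.pow_const _).smul ?_
  exact (profileDeriv n).continuous.measurable.comp (h1.smul (by fun_prop))

end Kernel

/-! ### Growth of `BMO` functions and action of the semigroup -/

section BMO

variable {n : ℕ}

/-- Polynomial growth of the integrals of a function of bounded mean oscillation over dyadic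
balls. -/
lemma MemBMO.exists_setIntegral_ball_le {a : Rn n → ℝ} (ha : MemBMO a) :
    ∃ D : ℝ, 0 ≤ D ∧ ∀ k : ℕ,
      ∫ y in Metric.ball 0 (2 ^ k), |a y| ≤ D * (2 ^ (n + 1)) ^ k := by
  obtain ⟨hloc, M, hM⟩ := ha
  have hint : ∀ r : ℝ, IntegrableOn a (Metric.ball 0 r) := fun r =>
    (hloc.integrableOn_isCompact (isCompact_closedBall 0 r)).mono_set Metric.ball_subset_closedBall
  set V : ℝ := volume.real (Metric.ball (0 : Rn n) 1) with hV
  have hV0 : 0 < V := ENNReal.toReal_pos (Metric.measure_ball_pos _ _ one_pos).ne'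
    measure_ball_lt_top.ne
  have hVk : ∀ k : ℕ, volume.real (Metric.ball (0 : Rn n) (2 ^ k)) = (2 ^ k) ^ n * V := by
    intro k
    have := Measure.addHaar_ball_of_pos (volume : Measure (Rn n)) 0 (r := 2 ^ k) (by positivity)
    rw [Measure.real, this, ENNReal.toReal_mul, ENNReal.toReal_ofReal (by positivity), hV]
    simp [Measure.real]
  set I : ℕ → ℝ := fun k => ∫ y in Metric.ball (0 : Rn n) (2 ^ k), |a y| with hI
  have hI0 : ∀ k, 0 ≤ I k := fun k => integral_nonneg fun y => abs_nonneg _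
  -- The mean `b` over the larger ball is estimated on the smaller one, where `|b| ≤ |a - b| + |a|`;
  -- passing from one ball to the other costs the volume ratio `2ⁿ`.
  have hstep : ∀ k, I (k + 1) ≤ 2 ^ n * I k + (2 ^ n + 1) * |M| * ((2 ^ (k + 1)) ^ n * V) := by
    intro k
    set b : ℝ := ⨍ z in Metric.ball (0 : Rn n) (2 ^ (k + 1)), a z
    have hconst : ∀ r : ℝ, IntegrableOn (fun _ : Rn n => b) (Metric.ball 0 r) := fun r =>
      integrableOn_const measure_ball_lt_top.ne
    have hosc : ∀ r : ℝ, IntegrableOn (fun y => |a y - b|) (Metric.ball 0 r) := fun r =>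
      ((hint r).sub (hconst r)).abs
    have h1 : ∫ y in Metric.ball (0 : Rn n) (2 ^ (k + 1)), |a y - b| ≤
        |M| * ((2 ^ (k + 1)) ^ n * V) := by
      have := (hM 0 (2 ^ (k + 1)) (by positivity)).trans (le_abs_self M)
      rw [setAverage_eq, hVk, smul_eq_mul, ← div_eq_inv_mul, div_le_iff₀ (by positivity)] at this
      exact this
    have hsub : Metric.ball (0 : Rn n) (2 ^ k) ⊆ Metric.ball 0 (2 ^ (k + 1)) :=
      Metric.ball_subset_ball (pow_le_pow_right₀ one_le_two (Nat.le_succ k))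
    have h2 : |b| * ((2 ^ k) ^ n * V) ≤ |M| * ((2 ^ (k + 1)) ^ n * V) + I k := by
      have e1 : |b| * ((2 ^ k) ^ n * V) = ∫ y in Metric.ball (0 : Rn n) (2 ^ k), |b| := by
        rw [setIntegral_const, hVk, smul_eq_mul, mul_comm]
      rw [e1]
      calc ∫ y in Metric.ball (0 : Rn n) (2 ^ k), |b|
          ≤ ∫ y in Metric.ball (0 : Rn n) (2 ^ k), (|a y - b| + |a y|) := by
            refine integral_mono (hconst _).abs ((hosc _).add (hint _).abs) fun y => ?_
            have := abs_sub_abs_le_abs_sub b (a y)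
            rw [abs_sub_comm] at this
            simp only
            linarith
        _ = (∫ y in Metric.ball (0 : Rn n) (2 ^ k), |a y - b|) + I k :=
            integral_add (hosc _) (hint _).abs
        _ ≤ _ := by
            gcongr
            exact (setIntegral_mono_set (hosc _) (Eventually.of_forall fun y => abs_nonneg _)
              hsub.eventuallyLE).trans h1
    have h3 : I (k + 1) ≤ |M| * ((2 ^ (k + 1)) ^ n * V) + |b| * ((2 ^ (k + 1)) ^ n * V) := by
      have e1 : |b| * ((2 ^ (k + 1)) ^ n * V) =
          ∫ y in Metric.ball (0 : Rn n) (2 ^ (k + 1)), |b| := by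
        rw [setIntegral_const, hVk, smul_eq_mul, mul_comm]
      calc I (k + 1)
          ≤ ∫ y in Metric.ball (0 : Rn n) (2 ^ (k + 1)), (|a y - b| + |b|) := by
            refine integral_mono (hint _).abs ((hosc _).add (hconst _).abs) fun y => ?_
            have := abs_add_le (a y - b) b
            simpa using this
        _ = (∫ y in Metric.ball (0 : Rn n) (2 ^ (k + 1)), |a y - b|) +
            ∫ y in Metric.ball (0 : Rn n) (2 ^ (k + 1)), |b| :=
            integral_add (hosc _) (hconst _).abs
        _ ≤ _ := by
            rw [e1]
            gcongr
    have h4 : ((2 : ℝ) ^ (k + 1)) ^ n * V = 2 ^ n * ((2 ^ k) ^ n * V) := by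
      rw [pow_succ, mul_pow]; ring
    calc I (k + 1) ≤ |M| * ((2 ^ (k + 1)) ^ n * V) + |b| * ((2 ^ (k + 1)) ^ n * V) := h3
      _ = |M| * ((2 ^ (k + 1)) ^ n * V) + 2 ^ n * (|b| * ((2 ^ k) ^ n * V)) := by rw [h4]; ring
      _ ≤ |M| * ((2 ^ (k + 1)) ^ n * V) + 2 ^ n * (|M| * ((2 ^ (k + 1)) ^ n * V) + I k) := by
          gcongr
      _ = _ := by ring
  set E : ℝ := (2 ^ n + 1) * |M| * V with hE
  have hE0 : 0 ≤ E := by positivity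
  -- The rate `2^(n+1)` leaves room for the oscillation added at each step: both summands in the
  -- recursion are at most `2ⁿ` times the inductive bound.
  refine ⟨I 0 + E, by have := hI0 0; positivity, fun k => ?_⟩
  induction k with
  | zero => simpa [hI] using hE0
  | succ k ih =>
    have h1 : ((2 : ℝ) ^ k) ^ n ≤ (2 ^ (n + 1)) ^ k := by
      rw [← pow_mul, ← pow_mul]
      exact pow_le_pow_right₀ one_le_two (by nlinarith)
    have hR : (0 : ℝ) ≤ (2 ^ (n + 1)) ^ k := by positivity
    calc I (k + 1) ≤ 2 ^ n * I k + (2 ^ n + 1) * |M| * ((2 ^ (k + 1)) ^ n * V) := hstep k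
      _ = 2 ^ n * I k + 2 ^ n * (E * (2 ^ k) ^ n) := by rw [pow_succ, mul_pow, hE]; ring
      _ ≤ 2 ^ n * ((I 0 + E) * (2 ^ (n + 1)) ^ k) + 2 ^ n * ((I 0 + E) * (2 ^ (n + 1)) ^ k) := by
          have := hI0 0
          gcongr
          linarith
      _ = _ := by ring

/-- A single term suffices, that of the smallest dyadic ball containing `y`: minimality gives `2^k ≤
2(1 + |y|)`, whence the factor `2^m`. -/
lemma inv_one_add_norm_pow_le_tsum (m : ℕ) (y : Rn n) :
    ENNReal.ofReal ((1 + ‖y‖) ^ m)⁻¹ ≤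
      ∑' k : ℕ, (2 ^ m * ((2 ^ m)⁻¹) ^ k) * (Metric.ball (0 : Rn n) (2 ^ k)).indicator 1 y := by
  classical
  have hex : ∃ k : ℕ, ‖y‖ < 2 ^ k := pow_unbounded_of_one_lt _ one_lt_two
  set k := Nat.find hex with hk
  have hky : ‖y‖ < 2 ^ k := Nat.find_spec hex
  refine le_trans ?_ (ENNReal.le_tsum k)
  have hmem : y ∈ Metric.ball (0 : Rn n) (2 ^ k) := by simpa using hky
  rw [indicator_of_mem hmem, Pi.one_apply, mul_one]
  have key : ((1 + ‖y‖) ^ m)⁻¹ ≤ 2 ^ m * ((2 ^ m)⁻¹) ^ k := by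
    have h2 : (2 : ℝ) ^ k ≤ 2 * (1 + ‖y‖) := by
      rcases Nat.eq_zero_or_pos k with h0 | h0
      · rw [h0, pow_zero]; linarith [norm_nonneg y]
      · have := Nat.find_min hex (m := k - 1) (by omega)
        rw [not_lt] at this
        have h3 : (2 : ℝ) ^ k = 2 * 2 ^ (k - 1) := by
          rw [← pow_succ']; congr 1; omega
        rw [h3]; linarith
    rw [inv_pow, ← div_eq_mul_inv, le_div_iff₀ (by positivity), ← div_eq_inv_mul,
      div_le_iff₀ (by positivity), ← mul_pow, ← pow_mul, mul_comm m k, pow_mul]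
    gcongr
  calc ENNReal.ofReal ((1 + ‖y‖) ^ m)⁻¹ ≤ ENNReal.ofReal (2 ^ m * ((2 ^ m)⁻¹) ^ k) :=
        ENNReal.ofReal_le_ofReal key
    _ = _ := by
        rw [ENNReal.ofReal_mul (by positivity), ENNReal.ofReal_pow (by positivity),
          ENNReal.ofReal_pow (by positivity), ENNReal.ofReal_inv_of_pos (by positivity),
          ENNReal.ofReal_pow (by positivity)]
        simp

/-- A function of bounded mean oscillation is integrable against a polynomial weight. -/
theorem MemBMO.integrable_mul_weight {a : Rn n → ℝ} (ha : MemBMO a) :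
    Integrable (fun y => ((1 + ‖y‖) ^ (n + 2))⁻¹ * a y) := by
  obtain ⟨D, hD, hDk⟩ := ha.exists_setIntegral_ball_le
  have hloc := ha.1
  have hcont : Continuous fun y : Rn n => ((1 + ‖y‖) ^ (n + 2))⁻¹ :=
    Continuous.inv₀ (by fun_prop) fun y => by positivity
  refine ⟨hcont.aestronglyMeasurable.mul hloc.aestronglyMeasurable, ?_⟩
  have hball : ∀ k : ℕ, ∫⁻ y in Metric.ball (0 : Rn n) (2 ^ k), ‖a y‖ₑ ≤
      ENNReal.ofReal D * (2 ^ (n + 1)) ^ k := by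
    intro k
    have hi : IntegrableOn a (Metric.ball 0 (2 ^ k)) :=
      (hloc.integrableOn_isCompact (isCompact_closedBall 0 _)).mono_set
        Metric.ball_subset_closedBall
    rw [← ofReal_integral_norm_eq_lintegral_enorm hi]
    refine (ENNReal.ofReal_le_ofReal (hDk k)).trans ?_
    rw [ENNReal.ofReal_mul hD, ENNReal.ofReal_pow (by positivity),
      ENNReal.ofReal_pow (by positivity)]
    simp
  rw [hasFiniteIntegral_iff_enorm]
  calc ∫⁻ y, ‖((1 + ‖y‖) ^ (n + 2))⁻¹ * a y‖ₑ
      ≤ ∫⁻ y, ∑' k : ℕ, (2 ^ (n + 2) * ((2 ^ (n + 2))⁻¹) ^ k) *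
          (Metric.ball (0 : Rn n) (2 ^ k)).indicator (fun y => ‖a y‖ₑ) y := by
        refine lintegral_mono fun y => ?_
        rw [enorm_mul, Real.enorm_of_nonneg (by positivity)]
        refine (mul_le_mul_left (inv_one_add_norm_pow_le_tsum (n + 2) y) _).trans ?_
        rw [← ENNReal.tsum_mul_right]
        refine ENNReal.tsum_le_tsum fun k => ?_
        rw [mul_assoc]
        gcongr
        by_cases h : y ∈ Metric.ball (0 : Rn n) (2 ^ k) <;> simp [h, indicator]
    _ = ∑' k : ℕ, (2 ^ (n + 2) * ((2 ^ (n + 2))⁻¹) ^ k) *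
          ∫⁻ y in Metric.ball (0 : Rn n) (2 ^ k), ‖a y‖ₑ := by
        rw [lintegral_tsum fun k => ((hloc.aestronglyMeasurable.enorm.indicator
          measurableSet_ball).const_mul _)]
        refine tsum_congr fun k => ?_
        rw [lintegral_const_mul'' _ (hloc.aestronglyMeasurable.enorm.indicator
          measurableSet_ball), lintegral_indicator measurableSet_ball]
    -- The weight exponent exceeds the growth exponent `n + 1` by one, which leaves the geometric
    -- ratio `1/2`.
    _ ≤ ∑' k : ℕ, (2 ^ (n + 2) * ENNReal.ofReal D) * (2⁻¹) ^ k := by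
        refine ENNReal.tsum_le_tsum fun k => ?_
        refine (mul_le_mul_right (hball k) _).trans (le_of_eq ?_)
        have : ((2 : ℝ≥0∞) ^ (n + 2))⁻¹ ^ k * (2 ^ (n + 1)) ^ k = 2⁻¹ ^ k := by
          rw [← mul_pow, pow_succ 2 (n + 1), ENNReal.mul_inv (by simp) (by simp), mul_comm,
            ← mul_assoc, ENNReal.mul_inv_cancel (by simp) (by simp), one_mul]
        rw [← this]; ring
    _ < ⊤ := by
        rw [ENNReal.tsum_mul_left, ENNReal.tsum_geometric]
        refine ENNReal.mul_lt_top (ENNReal.mul_lt_top (by simp) (by simp)) ?_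
        rw [ENNReal.one_sub_inv_two, inv_inv]
        simp

lemma integrable_heatKernel_mul {t : ℝ} (ht : 0 < t) {a : Rn n → ℝ} {m : ℕ}
    (ha : Integrable (fun y => ((1 + ‖y‖) ^ m)⁻¹ * a y))
    (ham : AEStronglyMeasurable a) (x : Rn n) :
    Integrable (fun y => heatKernel t (x - y) * a y) := by
  obtain ⟨K, hK, -⟩ := exists_schwartzMap_heatKernel (n := n) ht
  obtain ⟨C, hC, hdec⟩ := K.exists_norm_le_one_add_pow m
  have hKc : Continuous fun y => heatKernel t (x - y) := by
    simp_rw [← hK]; exact K.continuous.comp (by fun_prop)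
  refine (ha.norm.const_mul (C * (1 + ‖x‖) ^ m)).mono' (hKc.aestronglyMeasurable.mul ham)
    (Eventually.of_forall fun y => ?_)
  rw [norm_mul, norm_mul, ← hK, Real.norm_of_nonneg (r := ((1 + ‖y‖) ^ m)⁻¹) (by positivity),
    ← mul_assoc]
  gcongr
  refine (hdec _).trans ?_
  rw [mul_assoc]
  exact mul_le_mul_of_nonneg_left (inv_one_add_norm_sub_pow_le m x y) hC

/-- The semigroup preserves constant differences of `BMO` data. -/
theorem semigroup_sub_semigroup_eq_const {t : ℝ} (ht : 0 < t) {a b : Rn n → ℝ} (ha : MemBMO a)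
    {c : ℝ} (hab : ∀ᵐ x, a x - b x = c) (x : Rn n) :
    semigroup t a x - semigroup t b x = c := by
  -- Splitting the integral requires absolute convergence; this is where `BMO` enters.
  have hia := integrable_heatKernel_mul ht ha.integrable_mul_weight ha.1.aestronglyMeasurable x
  obtain ⟨K, hK, -⟩ := exists_schwartzMap_heatKernel (n := n) ht
  have hKi : Integrable (fun y => heatKernel t (x - y)) := by
    have := (K.integrable (μ := volume)).comp_sub_left x
    exact this.congr (Eventually.of_forall fun y => hK _)
  have hb : semigroup t b x = ∫ y, (heatKernel t (x - y) * a y - heatKernel t (x - y) * c) := by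
    refine integral_congr_ae ?_
    filter_upwards [hab] with y hy
    rw [← hy]; ring
  rw [hb, integral_sub hia (hKi.mul_const c), integral_mul_const,
    integral_sub_left_eq_self (fun y => heatKernel t y) volume x, integral_heatKernel ht, semigroup]
  ring

end BMO

/-! ### Weak derivatives and Lipschitz representatives -/

section WeakDeriv

variable {n : ℕ} {G : Type*} [NormedAddCommGroup G] [NormedSpace ℝ G]

lemma _root_.MeasureTheory.LocallyIntegrable.clm_apply {X 𝕜 V W : Type*} [TopologicalSpace X]
    [MeasurableSpace X] [NontriviallyNormedField 𝕜] [NormedAddCommGroup V] [NormedSpace 𝕜 V]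
    [NormedAddCommGroup W] [NormedSpace 𝕜 W] {μ : Measure X} {f : X → V →L[𝕜] W}
    (hf : LocallyIntegrable f μ) (e : V) : LocallyIntegrable (fun x => f x e) μ := fun x => by
  obtain ⟨s, hs, hi⟩ := hf x
  exact ⟨s, hs, hi.apply_continuousLinearMap e⟩

lemma _root_.MeasureTheory.LocallyIntegrable.integrable_contDiff_smul {f : Rn n → G}
    (hf : LocallyIntegrable f) {φ : Rn n → ℝ} (hφ : ContDiff ℝ ∞ φ) (hc : HasCompactSupport φ) :
    Integrable (fun x => φ x • f x) :=
  hf.integrable_smul_left_of_hasCompactSupport hφ.continuous hc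

lemma _root_.MeasureTheory.LocallyIntegrable.integrable_fderiv_smul {f : Rn n → G}
    (hf : LocallyIntegrable f) {φ : Rn n → ℝ} (hφ : ContDiff ℝ ∞ φ) (hc : HasCompactSupport φ)
    (e : Rn n) : Integrable (fun x => fderiv ℝ φ x e • f x) :=
  hf.integrable_smul_left_of_hasCompactSupport
    ((hφ.continuous_fderiv (by simp)).clm_apply continuous_const) (hc.fderiv_apply ℝ e)

lemma HasWeakFDeriv.sub {f g : Rn n → G} {f' g' : Rn n → Rn n →L[ℝ] G}
    (hf : HasWeakFDeriv f f') (hg : HasWeakFDeriv g g') :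
    HasWeakFDeriv (fun x => f x - g x) (fun x => f' x - g' x) := by
  refine ⟨hf.1.sub hg.1, hf.2.1.sub hg.2.1, fun φ hφ hc e => ?_⟩
  simp_rw [smul_sub, sub_apply, smul_sub]
  rw [integral_sub (hf.1.integrable_fderiv_smul hφ hc e) (hg.1.integrable_fderiv_smul hφ hc e),
    integral_sub ((hf.2.1.clm_apply e).integrable_contDiff_smul hφ hc)
      ((hg.2.1.clm_apply e).integrable_contDiff_smul hφ hc), hf.2.2 φ hφ hc e, hg.2.2 φ hφ hc e]
  abel

/-- Weak derivatives are unique up to null sets. -/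
theorem HasWeakFDeriv.ae_eq [CompleteSpace G] {f g : Rn n → G} {f' g' : Rn n → Rn n →L[ℝ] G}
    (hf : HasWeakFDeriv f f') (hg : HasWeakFDeriv g g') (hfg : f =ᵐ[volume] g) :
    f' =ᵐ[volume] g' := by
  have h : ∀ i : Fin n, ∀ᵐ x, f' x (EuclideanSpace.single i 1) =
      g' x (EuclideanSpace.single i 1) := by
    intro i
    refine ae_eq_of_integral_contDiff_smul_eq (hf.2.1.clm_apply _) (hg.2.1.clm_apply _)
      fun φ hφ hc => ?_
    have h1 := hf.2.2 φ hφ hc (EuclideanSpace.single i 1)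
    have h2 := hg.2.2 φ hφ hc (EuclideanSpace.single i 1)
    rw [← neg_inj, ← h1, ← h2]
    refine integral_congr_ae ?_
    filter_upwards [hfg] with x hx
    rw [hx]
  filter_upwards [ae_all_iff.2 h] with x hx
  have := (EuclideanSpace.basisFun (Fin n) ℝ).toBasis.ext (f₁ := (f' x).toLinearMap)
    (f₂ := (g' x).toLinearMap) fun i => by simpa using hx i
  exact ContinuousLinearMap.coe_injective this

/-- A real Lipschitz function is weakly differentiable. -/
lemma _root_.LipschitzWith.hasWeakFDeriv {f : Rn n → ℝ} {K : ℝ≥0} (hf : LipschitzWith K f) :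
    HasWeakFDeriv f (fderiv ℝ f) := by
  have hm : MemLp (fderiv ℝ f) ⊤ volume := memLp_top_of_bound
    (measurable_fderiv ℝ f).aestronglyMeasurable K
    (Eventually.of_forall fun x => norm_fderiv_le_of_lipschitz ℝ hf)
  refine ⟨hf.continuous.locallyIntegrable, hm.locallyIntegrable le_top, fun φ hφ hc e => ?_⟩
  obtain ⟨D, hD⟩ := (hφ.of_le (m := 1) (by simp)).lipschitzWith_of_hasCompactSupport hc (by simp)
  have h := hf.integral_lineDeriv_mul_eq (μ := volume) hD hc e
  have h1 : ∫ x, lineDeriv ℝ f x e * φ x = ∫ x, φ x • fderiv ℝ f x e := by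
    refine integral_congr_ae ?_
    filter_upwards [hf.ae_differentiableAt (μ := volume)] with x hx
    rw [hx.lineDeriv_eq_fderiv, smul_eq_mul, mul_comm]
  have h2 : ∫ x, lineDeriv ℝ φ x (-e) * f x = - ∫ x, fderiv ℝ φ x e • f x := by
    rw [← integral_neg]
    congr 1 with x
    rw [(hφ.differentiable (by simp) x).lineDeriv_eq_fderiv]
    simp
  rw [← h1, h, h2, neg_neg]

/-- A Lipschitz map between Euclidean spaces is weakly differentiable. -/
lemma _root_.LipschitzWith.hasWeakFDeriv_euclidean {m : ℕ} {f : Rn n → Rn m} {K : ℝ≥0}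
    (hf : LipschitzWith K f) : HasWeakFDeriv f (fderiv ℝ f) := by
  have hm : MemLp (fderiv ℝ f) ⊤ volume := memLp_top_of_bound
    (measurable_fderiv ℝ f).aestronglyMeasurable K
    (Eventually.of_forall fun x => norm_fderiv_le_of_lipschitz ℝ hf)
  have hl1 : LocallyIntegrable f := hf.continuous.locallyIntegrable
  have hl2 : LocallyIntegrable (fderiv ℝ f) := hm.locallyIntegrable le_top
  refine ⟨hl1, hl2, fun φ hφ hc e => ?_⟩
  ext i
  set π : Rn m →L[ℝ] ℝ := EuclideanSpace.proj i with hπ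
  have hi : LipschitzWith (‖π‖₊ * K)
      (fun x => f x i) :=
    π.lipschitz.comp hf
  have h := hi.hasWeakFDeriv.2.2 φ hφ hc e
  have c1 := π.integral_comp_comm
    (hl1.integrable_fderiv_smul hφ hc e)
  have c2 := π.integral_comp_comm
    ((hl2.clm_apply e).integrable_contDiff_smul hφ hc)
  simp only [hπ, PiLp.proj_apply, PiLp.smul_apply] at c1 c2
  rw [PiLp.neg_apply, ← c1, ← c2, h]
  congr 1
  refine integral_congr_ae ?_
  filter_upwards [hf.ae_differentiableAt (μ := volume)] with x hx
  have : HasFDerivAt (fun x => f x i)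
      (π.comp (fderiv ℝ f x)) x :=
    π.hasFDerivAt.comp x hx.hasFDerivAt
  rw [this.fderiv]
  rfl

/-- Mollifying a function with essentially bounded weak derivative yields a Lipschitz function. -/
lemma HasWeakFDeriv.lipschitzWith_convolution {f : Rn n → G} {f' : Rn n → Rn n →L[ℝ] G}
    (h : HasWeakFDeriv f f') {L : ℝ≥0} (hL : ∀ᵐ x, ‖f' x‖ ≤ L) (φ : ContDiffBump (0 : Rn n)) :
    LipschitzWith L (φ.normed volume ⋆[ContinuousLinearMap.lsmul ℝ ℝ] f) := by
  set ρ : Rn n → ℝ := φ.normed volume with hρ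
  have hρs : ContDiff ℝ ∞ ρ := φ.contDiff_normed
  have hρc : HasCompactSupport ρ := φ.hasCompactSupport_normed
  have hd := fun x => hρc.hasFDerivAt_convolution_left (ContinuousLinearMap.lsmul ℝ ℝ)
    (hρs.of_le (by simp)) h.1 x
  refine lipschitzWith_of_nnnorm_fderiv_le (𝕜 := ℝ) (fun x => (hd x).differentiableAt) fun x => ?_
  rw [(hd x).fderiv, ← NNReal.coe_le_coe, coe_nnnorm]
  refine ContinuousLinearMap.opNorm_le_bound _ L.2 fun e => ?_
  -- With the reflected mollifier as test function, the derivative of `ρ * f` becomes an average of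
  -- `f'` against the probability density `ρ`.
  have hψ : ContDiff ℝ ∞ (fun z => ρ (x - z)) := hρs.comp (contDiff_const.sub contDiff_id)
  have hψc : HasCompactSupport (fun z => ρ (x - z)) :=
    hρc.comp_homeomorph (Homeomorph.subLeft x)
  have hψd : ∀ z, fderiv ℝ (fun z => ρ (x - z)) z e = - fderiv ℝ ρ (x - z) e := by
    intro z
    have h1 := ((hρs.differentiable (by simp) (x - z)).hasFDerivAt).comp z
      ((hasFDerivAt_id z).const_sub x)
    have h2 : fderiv ℝ (fun z => ρ (x - z)) z = _ := h1.fderiv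
    rw [h2]; simp
  have hw := h.2.2 _ hψ hψc e
  have hconv : (fderiv ℝ ρ ⋆[(ContinuousLinearMap.lsmul ℝ ℝ).precompL (Rn n)] f) x e =
      ∫ z, ρ (x - z) • f' z e := by
    have hex := (hρc.fderiv ℝ).convolutionExists_left
      ((ContinuousLinearMap.lsmul ℝ ℝ : ℝ →L[ℝ] G →L[ℝ] G).precompL (Rn n))
      (hρs.continuous_fderiv (by simp)) h.1 x
    rw [convolution_def, ContinuousLinearMap.integral_apply hex,
      ← integral_sub_left_eq_self _ volume x]
    rw [← neg_inj, ← hw, ← integral_neg]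
    congr 1 with z
    rw [hψd, neg_smul, sub_sub_cancel]
    rfl
  have hρi : Integrable (fun z => ρ (x - z)) := by
    have : Integrable ρ := hρs.continuous.integrable_of_hasCompactSupport hρc
    exact this.comp_sub_left x
  rw [hconv]
  calc ‖∫ z, ρ (x - z) • f' z e‖ ≤ ∫ z, ρ (x - z) * (L * ‖e‖) := by
        refine norm_integral_le_of_norm_le (hρi.mul_const _) ?_
        filter_upwards [hL] with z hz
        rw [norm_smul, Real.norm_of_nonneg (φ.nonneg_normed _)]
        refine mul_le_mul_of_nonneg_left ?_ (φ.nonneg_normed _)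
        exact ((f' z).le_opNorm e).trans (by gcongr)
    _ = L * ‖e‖ := by
        rw [integral_mul_const, integral_sub_left_eq_self ρ volume x, hρ, φ.integral_normed,
          one_mul]

/-- A function with essentially bounded weak derivative has a Lipschitz representative. -/
theorem HasWeakFDeriv.exists_lipschitzWith_ae_eq [FiniteDimensional ℝ G] {f : Rn n → G}
    {f' : Rn n → Rn n →L[ℝ] G} (h : HasWeakFDeriv f f') {L : ℝ≥0} (hL : ∀ᵐ x, ‖f' x‖ ≤ L) :
    ∃ (K : ℝ≥0) (U : Rn n → G), LipschitzWith K U ∧ U =ᵐ[volume] f := by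
  have : CompleteSpace G := FiniteDimensional.complete ℝ G
  -- The inner radius is half the outer one, so the ratio bound `2` needed for a.e. convergence of
  -- the mollifications holds.
  let φ : ℕ → ContDiffBump (0 : Rn n) := fun k =>
    ⟨1 / (k + 1) / 2, 1 / (k + 1), by positivity, half_lt_self (by positivity)⟩
  have hφ : Tendsto (fun k => (φ k).rOut) atTop (𝓝 0) := tendsto_one_div_add_atTop_nhds_zero_nat
  have hae := ContDiffBump.ae_convolution_tendsto_right_of_locallyIntegrable (K := 2)
    (μ := volume) hφ (Eventually.of_forall fun k => by
      simp only [φ]; linarith) h.1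
  set S := {x | Tendsto (fun k => ((φ k).normed volume ⋆[ContinuousLinearMap.lsmul ℝ ℝ] f) x)
    atTop (𝓝 (f x))} with hS
  -- A uniform Lipschitz bound survives pointwise limits, so `f` itself is Lipschitz on the
  -- full-measure set `S`. Extending a vector-valued map from `S` may enlarge the constant, hence
  -- the unspecified `K`.
  have hlip : LipschitzOnWith L f S := by
    refine LipschitzOnWith.of_dist_le_mul fun x hx y hy => ?_
    exact le_of_tendsto (hx.dist hy) (Eventually.of_forall fun k =>
      (h.lipschitzWith_convolution hL (φ k)).dist_le_mul x y)
  obtain ⟨U, hU, hUS⟩ := hlip.extend_finite_dimension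
  refine ⟨_, U, hU, ?_⟩
  filter_upwards [hae] with x hx
  exact (hUS hx).symm

/-- Integration by parts of a Schwartz function against a bounded Lipschitz function. -/
theorem integral_lineDeriv_mul_schwartzMap {f : Rn n → ℝ} {K : ℝ≥0} (hf : LipschitzWith K f)
    {B : ℝ} (hB : ∀ x, |f x| ≤ B) (P : 𝓢(Rn n, ℝ)) (v : Rn n) :
    ∫ x, lineDeriv ℝ f x v * P x = - ∫ x, fderiv ℝ P x v * f x := by
  obtain ⟨C, hC, hP'⟩ := (SchwartzMap.fderivCLM ℝ (Rn n) ℝ P).exists_norm_le_one_add_pow (n + 1)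
  have hPi : Integrable (fun x => P x) := P.integrable
  have hA := hf.integral_inv_smul_sub_mul_tendsto_integral_lineDeriv_mul hPi v
  -- Integration by parts is obtained as the limit of the translation identity `hS` for difference
  -- quotients. Those of `P` are dominated thanks to the decay of its derivative.
  have hBt : Tendsto (fun t : ℝ => ∫ x, (t⁻¹ • (P (x + t • (-v)) - P x)) * f x) (𝓝[>] 0)
      (𝓝 (∫ x, fderiv ℝ P x (-v) * f x)) := by
    refine tendsto_integral_filter_of_dominated_convergence
      (fun x => C * (1 + ‖v‖) ^ (n + 1) * ‖v‖ * B * ((1 + ‖x‖) ^ (n + 1))⁻¹) ?_ ?_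
      ((integrable_inv_one_add_norm_pow n).const_mul _) ?_
    · filter_upwards with t
      have := P.continuous
      have := hf.continuous
      exact Continuous.aestronglyMeasurable (by fun_prop)
    · filter_upwards [Ioc_mem_nhdsGT zero_lt_one] with t ht
      filter_upwards with x
      have hd : ∀ w ∈ segment ℝ x (x + t • (-v)), ‖fderiv ℝ P w‖ ≤
          C * (1 + ‖v‖) ^ (n + 1) * ((1 + ‖x‖) ^ (n + 1))⁻¹ := by
        intro w hw
        obtain ⟨k, hk⟩ : ∃ k, w = x + k := ⟨w - x, by abel⟩
        have hkn : ‖k‖ ≤ ‖v‖ := by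
          have := segment_subset_closedBall_left x (x + t • (-v)) hw
          simp [hk, norm_smul, abs_of_pos ht.1] at this
          nlinarith [norm_nonneg v, ht.1, ht.2]
        refine (hP' w).trans ?_
        rw [hk, mul_assoc]
        refine mul_le_mul_of_nonneg_left ?_ hC
        refine (inv_one_add_norm_add_pow_le (n + 1) x k).trans ?_
        gcongr
      have h1 := (convex_segment x (x + t • (-v))).norm_image_sub_le_of_norm_fderiv_le (𝕜 := ℝ)
        (fun w _ => P.differentiableAt) hd (left_mem_segment ℝ _ _) (right_mem_segment ℝ _ _)
      rw [add_sub_cancel_left, norm_smul, norm_neg, Real.norm_of_nonneg ht.1.le] at h1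
      rw [norm_mul, norm_smul, norm_inv, Real.norm_of_nonneg ht.1.le]
      have h2 : t⁻¹ * ‖P (x + t • (-v)) - P x‖ ≤
          C * (1 + ‖v‖) ^ (n + 1) * ((1 + ‖x‖) ^ (n + 1))⁻¹ * ‖v‖ := by
        rw [← div_eq_inv_mul, div_le_iff₀ ht.1]
        linarith
      calc t⁻¹ * ‖P (x + t • (-v)) - P x‖ * ‖f x‖
          ≤ (C * (1 + ‖v‖) ^ (n + 1) * ((1 + ‖x‖) ^ (n + 1))⁻¹ * ‖v‖) * B :=
            mul_le_mul h2 (hB x) (norm_nonneg _) (by positivity)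
        _ = _ := by ring
    · filter_upwards with x
      have : HasLineDerivAt ℝ P (fderiv ℝ P x (-v)) x (-v) :=
        P.differentiableAt.hasFDerivAt.hasLineDerivAt (-v)
      exact this.tendsto_slope_zero_right.mul tendsto_const_nhds
  have hfint : ∀ Q : Rn n → ℝ, Integrable Q → Integrable (fun x => f x * Q x) := fun Q hQ =>
    hQ.bdd_mul hf.continuous.aestronglyMeasurable (Eventually.of_forall hB)
  have hfs : ∀ (h : Rn n) (Q : Rn n → ℝ), Integrable Q → Integrable (fun x => f (x + h) * Q x) :=
    fun h Q hQ => hQ.bdd_mul (hf.continuous.comp (by fun_prop)).aestronglyMeasurable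
      (Eventually.of_forall fun x => hB _)
  have hS : ∀ t : ℝ, ∫ x, (t⁻¹ • (f (x + t • v) - f x)) * P x =
      ∫ x, (t⁻¹ • (P (x + t • (-v)) - P x)) * f x := by
    intro t
    have hPs : Integrable (fun x => P (x + t • (-v))) := hPi.comp_add_right _
    have S3 : ∫ x, f (x + t • v) * P x = ∫ x, f x * P (x + t • (-v)) := by
      rw [← integral_add_right_eq_self _ (t • (-v))]; simp
    have S2 : ∫ x, (f (x + t • v) - f x) * P x = ∫ x, f x * (P (x + t • (-v)) - P x) := by
      simp_rw [sub_mul, mul_sub]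
      rw [integral_sub (hfs _ _ hPi) (hfint _ hPi), integral_sub (hfint _ hPs) (hfint _ hPi), S3]
    simp_rw [smul_eq_mul, mul_assoc, integral_const_mul, S2, mul_comm (f _)]
  simp only [hS] at hA
  rw [tendsto_nhds_unique hA hBt, ← integral_neg]
  simp

end WeakDeriv

/-! ### The nonlinearity in divergence form -/

section Flux

variable {n : ℕ}

/-- The classical derivative of a Lipschitz function is its weak derivative, and weak derivatives
are unique. This turns spatial Lipschitz bounds into gradient bounds. -/
lemma norm_weakGrad_le_of_lipschitzWith {w Ψ : Rn n → ℝ} {Dw : Rn n → Rn n}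
    (hw : HasWeakFDeriv w (fun x => innerSL ℝ (Dw x))) (hΨ : w =ᵐ[volume] Ψ) {K : ℝ≥0}
    (hK : LipschitzWith K Ψ) : ∀ᵐ x, ‖Dw x‖ ≤ K := by
  filter_upwards [hw.ae_eq hK.hasWeakFDeriv hΨ] with x hx
  rw [← innerSL_apply_norm (𝕜 := ℝ) (Dw x), hx]
  exact norm_fderiv_le_of_lipschitz ℝ hK

/-- Under the growth condition on `F'`, the map `F` is Lipschitz on balls, with a constant growing
quadratically in the radius. -/
lemma norm_flux_sub_le {F : Rn n → Rn n} (hF : ContDiff ℝ 1 F) {C : ℝ} (hC : 0 < C)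
    (hlip : ∀ ξ₁ ξ₂ : Rn n,
      ‖fderiv ℝ F ξ₁ - fderiv ℝ F ξ₂‖ ≤ C * (‖ξ₁‖ + ‖ξ₂‖) * ‖ξ₁ - ξ₂‖)
    {b : ℝ} {ξ₁ ξ₂ : Rn n} (h₁ : ‖ξ₁‖ ≤ b) (h₂ : ‖ξ₂‖ ≤ b) :
    ‖F ξ₁ - F ξ₂‖ ≤ (‖fderiv ℝ F 0‖ + C * b ^ 2) * ‖ξ₁ - ξ₂‖ := by
  have hd : ∀ ξ ∈ Metric.closedBall (0 : Rn n) b, ‖fderiv ℝ F ξ‖ ≤ ‖fderiv ℝ F 0‖ + C * b ^ 2 := by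
    intro ξ hξ
    have hξ' : ‖ξ‖ ≤ b := by simpa using hξ
    have h := hlip ξ 0
    rw [norm_zero, add_zero, sub_zero] at h
    have h3 := norm_le_norm_add_norm_sub' (fderiv ℝ F ξ) (fderiv ℝ F 0)
    have : C * ‖ξ‖ * ‖ξ‖ ≤ C * b ^ 2 := by
      rw [mul_assoc, ← sq]; gcongr
    linarith
  exact (convex_closedBall (0 : Rn n) b).norm_image_sub_le_of_norm_fderiv_le (𝕜 := ℝ)
    (fun ξ _ => hF.differentiable one_ne_zero ξ) hd (by simpa using h₂) (by simpa using h₁)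

/-- Integration by parts in the nonlinearity: `S(t) ∇·F(∇u) = ∇S(t) · F(∇u)`. -/
theorem semigroup_divFlux_eq {F : Rn n → Rn n} (hF : ContDiff ℝ 1 F) {D : Rn n → Rn n}
    {D2 : Rn n → Rn n →L[ℝ] Rn n} (hD : HasWeakFDeriv D D2) {B : ℝ} (hB : ∀ᵐ x, ‖D x‖ ≤ B)
    {L : ℝ≥0} (hL : ∀ᵐ x, ‖D2 x‖ ≤ L) {t : ℝ} (ht : 0 < t) (x : Rn n) :
    semigroup t (fun y => divFlux F (D y) (D2 y)) x =
      ∫ y, gradKernel t (x - y) (F (D y)) := by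
  obtain ⟨K, U, hU, hUD⟩ := hD.exists_lipschitzWith_ae_eq hL
  -- A closed condition that holds almost everywhere holds on a dense set, hence everywhere. Thus
  -- `U` stays in a ball on which `F` is Lipschitz, and `F ∘ U` is bounded and Lipschitz.
  have hUB : ∀ y, ‖U y‖ ≤ B := by
    have hd : Dense {y | ‖U y‖ ≤ B} := Measure.dense_of_ae (μ := volume) (by
      filter_upwards [hB, hUD] with y h1 h2
      rw [h2]; exact h1)
    intro y
    have hcl : IsClosed {y | ‖U y‖ ≤ B} := isClosed_le hU.continuous.norm continuous_const
    have := hd.closure_eq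
    rw [hcl.closure_eq] at this
    exact eq_univ_iff_forall.1 this y
  obtain ⟨A, hA⟩ := (isCompact_closedBall (0 : Rn n) B).exists_bound_of_continuousOn
    (hF.continuous_fderiv one_ne_zero).continuousOn
  have hFl : LipschitzOnWith A.toNNReal F (Metric.closedBall 0 B) :=
    (convex_closedBall (0 : Rn n) B).lipschitzOnWith_of_nnnorm_fderiv_le (𝕜 := ℝ)
      (fun ξ _ => hF.differentiable one_ne_zero ξ) fun ξ hξ => by
        rw [← NNReal.coe_le_coe, coe_nnnorm]
        exact (hA ξ hξ).trans (Real.le_coe_toNNReal A)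
  obtain ⟨Q, hQ⟩ := (isCompact_closedBall (0 : Rn n) B).exists_bound_of_continuousOn
    hF.continuous.continuousOn
  have hFU : LipschitzWith (A.toNNReal * K) (fun y => F (U y)) := by
    rw [← lipschitzOnWith_univ]
    exact hFl.comp hU.lipschitzOnWith fun y _ => by simpa using hUB y
  have hpr : ∀ i : Fin n, LipschitzWith 1 (fun ξ : Rn n => ξ i) := fun i =>
    LipschitzWith.of_dist_le_mul fun a b => by
      rw [NNReal.coe_one, one_mul, dist_eq_norm, dist_eq_norm]
      exact PiLp.norm_apply_le (a - b) i
  have hfi : ∀ i : Fin n, LipschitzWith (1 * (A.toNNReal * K)) (fun y => F (U y) i) := fun i =>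
    (hpr i).comp hFU
  have hfb : ∀ (i : Fin n) (y : Rn n), |F (U y) i| ≤ Q := fun i y =>
    (PiLp.norm_apply_le (F (U y)) i).trans (hQ _ (by simpa using hUB y))
  obtain ⟨Kt, hKt, hKt'⟩ := exists_schwartzMap_heatKernel (n := n) ht
  have hiso : AntilipschitzWith 1 (fun y : Rn n => x - y) :=
    (IsometryEquiv.subLeft x).isometry.antilipschitz
  set P : 𝓢(Rn n, ℝ) := SchwartzMap.compCLMOfAntilipschitz ℝ (g := fun y : Rn n => x - y)
    ((Function.HasTemperateGrowth.const x).sub Function.HasTemperateGrowth.id') hiso Kt with hP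
  have hPx : ∀ y, P y = heatKernel t (x - y) := fun y => hKt (x - y)
  have hPd : ∀ y e, fderiv ℝ P y e = - gradKernel t (x - y) e := by
    intro y e
    have h1 := (hasFDerivAt_heatKernel ht (x - y)).comp y ((hasFDerivAt_id y).const_sub x)
    have h2 : (P : Rn n → ℝ) = heatKernel t ∘ fun y => x - y := funext hPx
    rw [h2, show fderiv ℝ (heatKernel t ∘ fun y => x - y) y = _ from h1.fderiv]
    simp
  -- Rademacher's theorem makes the chain rule classical at almost every point.
  have hdiv : ∀ᵐ y, divFlux F (D y) (D2 y) =
      ∑ i, lineDeriv ℝ (fun y => F (U y) i) y (EuclideanSpace.single i 1) := by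
    filter_upwards [hUD, hU.ae_differentiableAt (μ := volume),
      hU.hasWeakFDeriv_euclidean.ae_eq hD hUD] with y h1 h2 h3
    rw [divFlux]
    refine Finset.sum_congr rfl fun i _ => ?_
    have hc : HasFDerivAt (fun y => F (U y)) ((fderiv ℝ F (U y)).comp (fderiv ℝ U y)) y :=
      (hF.differentiable one_ne_zero (U y)).hasFDerivAt.comp y h2.hasFDerivAt
    have hi := (EuclideanSpace.proj (𝕜 := ℝ) i : Rn n →L[ℝ] ℝ).hasFDerivAt.comp y hc
    have hl := hi.hasLineDerivAt (EuclideanSpace.single i 1)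
    have hl' : HasLineDerivAt ℝ (fun y => F (U y) i) _ y (EuclideanSpace.single i 1) := hl
    rw [hl'.lineDeriv, ← h1, ← h3]
    rfl
  have hPi : Integrable (fun y => P y) := P.integrable
  have hli : ∀ i : Fin n, Integrable (fun y =>
      lineDeriv ℝ (fun y => F (U y) i) y (EuclideanSpace.single i 1) * P y) := fun i =>
    hPi.bdd_mul (aestronglyMeasurable_lineDeriv (hfi i).continuous volume)
      (Eventually.of_forall fun y => norm_lineDeriv_le_of_lipschitz ℝ (hfi i))
  have hgi : ∀ i : Fin n, Integrable (fun y =>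
      fderiv ℝ P y (EuclideanSpace.single i 1) * F (U y) i) := fun i => by
    have h1 : Integrable (fun y => fderiv ℝ P y (EuclideanSpace.single i 1)) :=
      (SchwartzMap.fderivCLM ℝ (Rn n) ℝ P).integrable.apply_continuousLinearMap _
    exact h1.mul_bdd (hfi i).continuous.aestronglyMeasurable
      (Eventually.of_forall (hfb i))
  calc semigroup t (fun y => divFlux F (D y) (D2 y)) x
      = ∫ y, ∑ i, lineDeriv ℝ (fun y => F (U y) i) y (EuclideanSpace.single i 1) * P y := by
        refine integral_congr_ae ?_
        filter_upwards [hdiv] with y hy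
        rw [hy, ← hPx, mul_comm, Finset.sum_mul]
    _ = ∑ i, ∫ y, lineDeriv ℝ (fun y => F (U y) i) y (EuclideanSpace.single i 1) * P y :=
        integral_finsetSum _ fun i _ => hli i
    _ = - ∑ i, ∫ y, fderiv ℝ P y (EuclideanSpace.single i 1) * F (U y) i := by
        rw [← Finset.sum_neg_distrib]
        exact Finset.sum_congr rfl fun i _ =>
          integral_lineDeriv_mul_schwartzMap (hfi i) (hfb i) P _
    _ = ∫ y, gradKernel t (x - y) (F (D y)) := by
        rw [← integral_finsetSum _ fun i _ => hgi i, ← integral_neg]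
        refine integral_congr_ae ?_
        filter_upwards [hUD] with y hy
        rw [hy]
        have hsum : F (D y) = ∑ i, (F (D y) i) • EuclideanSpace.single i (1 : ℝ) := by
          have := (EuclideanSpace.basisFun (Fin n) ℝ).sum_repr (F (D y))
          simpa using this.symm
        conv_rhs => rw [hsum]
        simp [hPd, mul_comm]

end Flux

/-! ### Pointwise bounds from the norm of `X_T` -/

section Jets

variable {n : ℕ}

lemma Ninfty_ae_le {G : Type*} [NormedAddCommGroup G] {k : ℕ} {T : ℝ} {D : ℝ → Rn n → G}
    {K : ℝ≥0} (h : Ninfty k T D ≤ K) {t : ℝ} (ht : t ∈ Ioc 0 T) :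
    ∀ᵐ x, ‖D t x‖ ≤ K * t ^ (-((k : ℝ) / 4)) := by
  have h1 : ENNReal.ofReal (t ^ ((k : ℝ) / 4)) * eLpNorm (D t) ⊤ volume ≤ K :=
    (le_iSup₂ (f := fun t (_ : t ∈ Ioc (0 : ℝ) T) =>
      ENNReal.ofReal (t ^ ((k : ℝ) / 4)) * eLpNorm (D t) ⊤ volume) t ht).trans h
  have hpos : 0 < t ^ ((k : ℝ) / 4) := Real.rpow_pos_of_pos ht.1 _
  have h2 : ∀ᵐ x, ‖D t x‖ₑ ≤ eLpNorm (D t) ⊤ volume := by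
    rw [eLpNorm_exponent_top]; exact enorm_ae_le_eLpNormEssSup _ _
  filter_upwards [h2] with x hx
  have h3 : ENNReal.ofReal (t ^ ((k : ℝ) / 4) * ‖D t x‖) ≤ ENNReal.ofReal K := by
    rw [ENNReal.ofReal_mul hpos.le, ofReal_norm, ENNReal.ofReal_coe_nnreal]
    exact (mul_le_mul_right hx _).trans h1
  rw [ENNReal.ofReal_le_ofReal_iff K.coe_nonneg] at h3
  rw [Real.rpow_neg ht.1.le, ← div_eq_mul_inv, le_div_iff₀ hpos, mul_comm]
  exact h3

/-- Pointwise bounds for a weak jet coming from a bound of the norm of `X_T`. -/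
lemma IsWeakJet.ae_le_of_XNorm_lt {T T' : ℝ} {u : ℝ → Rn n → ℝ} {Du : ℝ → Rn n → Rn n}
    {D2u : ℝ → Rn n → Rn n →L[ℝ] Rn n} (hj : IsWeakJet T u Du D2u) (hT : T' ≤ T) {K : ℝ≥0}
    (hK : XNorm T' u < K) {t : ℝ} (ht : t ∈ Ioc 0 T') :
    (∀ᵐ x, ‖Du t x‖ ≤ K * t ^ (-(1 : ℝ) / 4)) ∧ ∃ L : ℝ≥0, ∀ᵐ x, ‖D2u t x‖ ≤ L := by
  -- The infimum only yields some jet with the bound; uniqueness of weak derivatives transfers it to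
  -- the given jet.
  simp only [XNorm, iInf_lt_iff] at hK
  obtain ⟨Du', D2u', hj', hlt⟩ := hK
  have htT : t ∈ Ioc 0 T := ⟨ht.1, ht.2.trans hT⟩
  have e1 : Du t =ᵐ[volume] Du' t := by
    filter_upwards [(hj.weak_grad t htT).ae_eq (hj'.weak_grad t ht) (ae_eq_refl _)] with x hx
    exact (innerSL_inj (𝕜 := ℝ)).1 hx
  have e2 : D2u t =ᵐ[volume] D2u' t := (hj.weak_hess t htT).ae_eq (hj'.weak_hess t ht) e1
  have b1 : Ninfty 1 T' Du' ≤ K := (le_self_add.trans le_self_add).trans hlt.le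
  have b2 : Ninfty 2 T' D2u' ≤ K := (le_self_add.trans le_add_self).trans hlt.le
  constructor
  · filter_upwards [e1, Ninfty_ae_le b1 ht] with x h1 h2
    rw [h1]
    simpa [neg_div] using h2
  · refine ⟨(K * t ^ (-(((2 : ℕ) : ℝ) / 4))).toNNReal, ?_⟩
    filter_upwards [e2, Ninfty_ae_le b2 ht] with x h1 h2
    rw [h1]
    exact h2.trans (Real.le_coe_toNNReal _)

end Jets

/-! ### Beta integrals in time -/

section SingularIntegral

/-- The integrand is the modulus of that of the complex Beta integral at `(1 - b, 1 - a)`. -/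
lemma intervalIntegrable_one_sub_rpow_mul_rpow {a b : ℝ} (ha : a < 1) (hb : b < 1) :
    IntervalIntegrable (fun s : ℝ => (1 - s) ^ (-a) * s ^ (-b)) volume 0 1 := by
  have h := (Complex.betaIntegral_convergent (u := ((1 - b : ℝ) : ℂ)) (v := ((1 - a : ℝ) : ℂ))
    (by simpa using hb) (by simpa using ha)).norm
  rw [intervalIntegrable_iff_integrableOn_Ioo_of_le zero_le_one] at h ⊢
  refine h.congr_fun (fun s hs => ?_) measurableSet_Ioo
  have h1 : ((s : ℂ) ^ (((1 - b : ℝ) : ℂ) - 1)) = ((s ^ (-b) : ℝ) : ℂ) := by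
    rw [Complex.ofReal_cpow hs.1.le]; congr 1; push_cast; ring
  have h2 : ((1 - (s : ℂ)) ^ (((1 - a : ℝ) : ℂ) - 1)) = (((1 - s) ^ (-a) : ℝ) : ℂ) := by
    rw [Complex.ofReal_cpow (by linarith [hs.2])]; congr 1 <;> push_cast <;> ring
  simp only
  rw [h1, h2, ← Complex.ofReal_mul, Complex.norm_real, Real.norm_of_nonneg, mul_comm]
  exact mul_nonneg (Real.rpow_nonneg hs.1.le _) (Real.rpow_nonneg (by linarith [hs.2]) _)

/-- The Beta function `∫₀¹ (1-s)^(-a) s^(-b) ds`. -/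
def betaConst (a b : ℝ) : ℝ := ∫ s in (0 : ℝ)..1, (1 - s) ^ (-a) * s ^ (-b)

lemma betaConst_nonneg (a b : ℝ) : 0 ≤ betaConst a b :=
  intervalIntegral.integral_nonneg zero_le_one fun s hs =>
    mul_nonneg (Real.rpow_nonneg (by linarith [hs.2]) _) (Real.rpow_nonneg hs.1 _)

lemma sub_rpow_mul_rpow_eq {t : ℝ} (ht : 0 < t) (a b : ℝ) {s : ℝ} (hs : s ∈ Icc 0 t) :
    (t - s) ^ (-a) * s ^ (-b) =
      t ^ (-a - b) * ((1 - s / t) ^ (-a) * (s / t) ^ (-b)) := by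
  have h1 : t - s = t * (1 - s / t) := by field_simp
  have h2 : 0 ≤ 1 - s / t := by
    rw [sub_nonneg, div_le_one ht]; exact hs.2
  rw [h1, Real.mul_rpow ht.le h2, Real.div_rpow hs.1 ht.le,
    show -a - b = -a + -b by ring, Real.rpow_add ht]
  have := (Real.rpow_pos_of_pos ht (-b)).ne'
  field_simp

lemma intervalIntegrable_sub_rpow_mul_rpow {a b : ℝ} (ha : a < 1) (hb : b < 1) {t : ℝ}
    (ht : 0 < t) : IntervalIntegrable (fun s : ℝ => (t - s) ^ (-a) * s ^ (-b)) volume 0 t := by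
  have h := ((intervalIntegrable_one_sub_rpow_mul_rpow ha hb).comp_mul_right (c := t⁻¹)).const_mul (t ^ (-a - b))
  simp only [zero_div, one_div, inv_inv] at h
  rw [intervalIntegrable_iff_integrableOn_Ioc_of_le ht.le] at h ⊢
  refine h.congr_fun (fun s hs => ?_) measurableSet_Ioc
  rw [sub_rpow_mul_rpow_eq ht a b ⟨hs.1.le, hs.2⟩, div_eq_mul_inv]

lemma integral_sub_rpow_mul_rpow (a b : ℝ) {t : ℝ} (ht : 0 < t) :
    ∫ s in (0 : ℝ)..t, (t - s) ^ (-a) * s ^ (-b) = betaConst a b * t ^ (1 - a - b) := by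
  have h1 : ∫ s in (0 : ℝ)..t, (t - s) ^ (-a) * s ^ (-b) =
      ∫ s in (0 : ℝ)..t, t ^ (-a - b) * ((1 - s / t) ^ (-a) * (s / t) ^ (-b)) :=
    intervalIntegral.integral_congr fun s hs => by
      rw [uIcc_of_le ht.le] at hs
      exact sub_rpow_mul_rpow_eq ht a b hs
  rw [h1, intervalIntegral.integral_const_mul,
    intervalIntegral.integral_comp_div (fun s => (1 - s) ^ (-a) * s ^ (-b)) ht.ne', zero_div,
    div_self ht.ne', smul_eq_mul, ← betaConst, show 1 - a - b = 1 + (-a - b) by ring,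
    Real.rpow_add ht, Real.rpow_one]
  ring

lemma invScale_eq (t : ℝ) : invScale t = t ^ (-(1 / 4 : ℝ)) := by rw [invScale]; norm_num

lemma invScale_sq {t : ℝ} (ht : 0 ≤ t) : invScale t ^ 2 = t ^ (-(1 / 2 : ℝ)) := by
  rw [invScale, ← Real.rpow_natCast, ← Real.rpow_mul ht]; norm_num

end SingularIntegral

/-! ### The Duhamel term and its spatial Lipschitz bound -/

section Duhamel

variable {n : ℕ}

/-- A measurable vector field on `(0,T] × ℝⁿ` of size `M s^(-3/4)` at time `s`. -/
structure IsFlux (T M : ℝ) (G : ℝ → Rn n → Rn n) : Prop where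
  aesm : AEStronglyMeasurable (fun p : ℝ × Rn n => G p.1 p.2)
    ((volume.restrict (Ioc 0 T)).prod volume)
  aesm_slice : ∀ s ∈ Ioc 0 T, AEStronglyMeasurable (G s) volume
  bound : ∀ s ∈ Ioc 0 T, ∀ᵐ y, ‖G s y‖ ≤ M * s ^ (-(3 / 4 : ℝ))

lemma IsFlux.mono {T M M' : ℝ} {G : ℝ → Rn n → Rn n} (hG : IsFlux T M G) (hM : M ≤ M') :
    IsFlux T M' G := by
  refine ⟨hG.aesm, hG.aesm_slice, fun s hs => ?_⟩
  have := Real.rpow_nonneg hs.1.le (-(3 / 4 : ℝ))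
  filter_upwards [hG.bound s hs] with y hy
  exact hy.trans (by gcongr)

/-- The integrand `(∇S(t-s) · G(s))(x)` of the Duhamel term. -/
def duhamelIntegrand (G : ℝ → Rn n → Rn n) (t : ℝ) (x : Rn n) (s : ℝ) : ℝ :=
  ∫ y, gradKernel (t - s) (x - y) (G s y)

lemma integrable_gradKernel_apply {t : ℝ} (ht : 0 < t) {g : Rn n → Rn n} {b : ℝ}
    (hg : AEStronglyMeasurable g) (hb : ∀ᵐ y, ‖g y‖ ≤ b) (x : Rn n) :
    Integrable (fun y => gradKernel t (x - y) (g y)) := by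
  have hk : Integrable (fun y => gradKernel t (x - y)) :=
    (integrable_gradKernel ht).comp_sub_left x
  refine (hk.norm.mul_const b).mono' ?_ ?_
  · exact (ContinuousLinearMap.apply ℝ ℝ).flip.aestronglyMeasurable_comp₂
      hk.aestronglyMeasurable hg
  · filter_upwards [hb] with y hy
    exact (ContinuousLinearMap.le_opNorm _ _).trans (by gcongr)

lemma norm_integral_gradKernel_apply_le {t : ℝ} (ht : 0 < t) {g : Rn n → Rn n} {b : ℝ}
    (hb : ∀ᵐ y, ‖g y‖ ≤ b) (x : Rn n) :
    ‖∫ y, gradKernel t (x - y) (g y)‖ ≤ invScale t * (∫ z, ‖profileDeriv n z‖) * b := by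
  have hk : Integrable (fun y => gradKernel t (x - y)) :=
    (integrable_gradKernel ht).comp_sub_left x
  rw [← integral_norm_gradKernel ht,
    ← integral_sub_left_eq_self (fun z => ‖gradKernel t z‖) volume x, ← integral_mul_const]
  refine norm_integral_le_of_norm_le (hk.norm.mul_const b) ?_
  filter_upwards [hb] with y hy
  exact (ContinuousLinearMap.le_opNorm _ _).trans (by gcongr)

/-- The kernel contributes `(t-s)^(-1/4)` and the flux `s^(-3/4)`, both integrable singularities. -/
lemma IsFlux.intervalIntegrable {T M : ℝ} {G : ℝ → Rn n → Rn n} (hG : IsFlux T M G) {t : ℝ}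
    (ht : t ∈ Ioc 0 T) (x : Rn n) :
    IntervalIntegrable (duhamelIntegrand G t x) volume 0 t := by
  set N := ∫ z, ‖profileDeriv n z‖
  have hdom := (intervalIntegrable_sub_rpow_mul_rpow (a := 1 / 4) (b := 3 / 4) (by norm_num)
    (by norm_num) ht.1).const_mul (N * M)
  rw [intervalIntegrable_iff_integrableOn_Ioc_of_le ht.1.le] at hdom ⊢
  refine hdom.mono' ?_ ?_
  · have h1 : AEStronglyMeasurable (fun p : ℝ × Rn n => G p.1 p.2)
        ((volume.restrict (Ioc 0 t)).prod volume) :=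
      hG.aesm.mono_measure (Measure.prod_mono
        (Measure.restrict_mono (Ioc_subset_Ioc_right ht.2) le_rfl) le_rfl)
    have h2 : AEStronglyMeasurable
        (fun p : ℝ × Rn n => gradKernel (t - p.1) (x - p.2) (G p.1 p.2))
        ((volume.restrict (Ioc 0 t)).prod volume) :=
      (ContinuousLinearMap.apply ℝ ℝ).flip.aestronglyMeasurable_comp₂
        (measurable_gradKernel_uncurry t x).aestronglyMeasurable h1
    exact h2.integral_prod_right'
  -- The null endpoint `s = t` is dropped because the kernel bounds need `t - s > 0`.
  · rw [← restrict_Ioo_eq_restrict_Ioc]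
    filter_upwards [ae_restrict_mem measurableSet_Ioo] with s hs
    refine (norm_integral_gradKernel_apply_le (sub_pos.2 hs.2)
      (hG.bound s ⟨hs.1, hs.2.le.trans ht.2⟩) x).trans (le_of_eq ?_)
    rw [invScale_eq]; ring

/-- The Duhamel term `∫₀ᵗ ∇S(t-s) · G(s) ds`. -/
def duhamel (G : ℝ → Rn n → Rn n) (t : ℝ) (x : Rn n) : ℝ :=
  ∫ s in (0 : ℝ)..t, duhamelIntegrand G t x s

lemma duhamel_sub {T M M' : ℝ} {G G' : ℝ → Rn n → Rn n} (hG : IsFlux T M G)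
    (hG' : IsFlux T M' G') {t : ℝ} (ht : t ∈ Ioc 0 T) (x : Rn n) :
    duhamel G t x - duhamel G' t x = duhamel (fun s y => G s y - G' s y) t x := by
  rw [duhamel, duhamel, duhamel,
    ← intervalIntegral.integral_sub (hG.intervalIntegrable ht x) (hG'.intervalIntegrable ht x),
    intervalIntegral.integral_of_le ht.1.le, intervalIntegral.integral_of_le ht.1.le,
    integral_Ioc_eq_integral_Ioo, integral_Ioc_eq_integral_Ioo]
  refine setIntegral_congr_fun measurableSet_Ioo fun s hs => ?_
  have hsT : s ∈ Ioc 0 T := ⟨hs.1, hs.2.le.trans ht.2⟩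
  simp only [duhamelIntegrand, map_sub]
  rw [integral_sub
    (integrable_gradKernel_apply (sub_pos.2 hs.2) (hG.aesm_slice s hsT) (hG.bound s hsT) x)
    (integrable_gradKernel_apply (sub_pos.2 hs.2) (hG'.aesm_slice s hsT) (hG'.bound s hsT) x)]

lemma duhamel_eq_zero {G : ℝ → Rn n → Rn n} {t : ℝ} (ht : 0 < t)
    (hG : ∀ s ∈ Ioo 0 t, ∀ᵐ y, G s y = 0) (x : Rn n) : duhamel G t x = 0 := by
  rw [duhamel, intervalIntegral.integral_of_le ht.le, integral_Ioc_eq_integral_Ioo]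
  refine setIntegral_eq_zero_of_forall_eq_zero fun s hs => ?_
  refine integral_eq_zero_of_ae ?_
  filter_upwards [hG s hs] with y hy
  simp [hy]

/-- The Duhamel term is Lipschitz in space as soon as `(t-s)^(-1/2) ‖G(s)‖_∞` is integrable. -/
theorem exists_duhamel_lipschitzWith (n : ℕ) : ∃ N : ℝ, 0 ≤ N ∧
    ∀ (T M : ℝ) (G G' : ℝ → Rn n → Rn n), IsFlux T M G → IsFlux T M G' → ∀ t ∈ Ioc 0 T,
    ∀ m : ℝ → ℝ, IntervalIntegrable m volume 0 t →
    (∀ s ∈ Ioo 0 t, ∃ b, (∀ᵐ y, ‖G s y - G' s y‖ ≤ b) ∧ (t - s) ^ (-(1 / 2 : ℝ)) * b ≤ m s) →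
    LipschitzWith (N * ∫ s in (0 : ℝ)..t, m s).toNNReal
      (duhamel (fun s y => G s y - G' s y) t) := by
  obtain ⟨N, hN, H⟩ := exists_integral_norm_gradKernel_sub_le n
  refine ⟨N, hN, fun T M G G' hG hG' t ht m hm hb => ?_⟩
  refine LipschitzWith.of_dist_le_mul fun x z => ?_
  set W := fun s y => G s y - G' s y with hW
  have hWi : ∀ x, IntervalIntegrable (duhamelIntegrand W t x) volume 0 t := by
    intro x
    refine ((hG.intervalIntegrable ht x).sub (hG'.intervalIntegrable ht x)).congr_ae ?_
    rw [uIoc_of_le ht.1.le, ← restrict_Ioo_eq_restrict_Ioc]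
    filter_upwards [ae_restrict_mem measurableSet_Ioo] with s hs
    have hsT : s ∈ Ioc 0 T := ⟨hs.1, hs.2.le.trans ht.2⟩
    simp only [duhamelIntegrand, hW, map_sub]
    rw [integral_sub
      (integrable_gradKernel_apply (sub_pos.2 hs.2) (hG.aesm_slice s hsT) (hG.bound s hsT) x)
      (integrable_gradKernel_apply (sub_pos.2 hs.2) (hG'.aesm_slice s hsT) (hG'.bound s hsT) x)]
  -- The integrable majorant `m` stands in for the supremum norms of the slices, so their
  -- measurability in time need not be discussed.
  have hmain : ‖duhamel W t x - duhamel W t z‖ ≤ ∫ s in (0 : ℝ)..t, N * ‖x - z‖ * m s := by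
    rw [duhamel, duhamel, ← intervalIntegral.integral_sub (hWi x) (hWi z),
      intervalIntegral.integral_of_le ht.1.le, intervalIntegral.integral_of_le ht.1.le]
    have hmi := hm.const_mul (N * ‖x - z‖)
    rw [intervalIntegrable_iff_integrableOn_Ioc_of_le ht.1.le] at hmi
    refine norm_integral_le_of_norm_le hmi ?_
    rw [← restrict_Ioo_eq_restrict_Ioc]
    filter_upwards [ae_restrict_mem measurableSet_Ioo] with s hs
    have hsT : s ∈ Ioc 0 T := ⟨hs.1, hs.2.le.trans ht.2⟩
    have hpos : 0 < t - s := sub_pos.2 hs.2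
    obtain ⟨b, hb1, hb2⟩ := hb s hs
    have hWm : AEStronglyMeasurable (W s) := (hG.aesm_slice s hsT).sub (hG'.aesm_slice s hsT)
    have hb0 : 0 ≤ b := by
      obtain ⟨y, hy⟩ := hb1.exists
      exact (norm_nonneg _).trans hy
    have hkx : ∀ x : Rn n, Integrable (fun y => gradKernel (t - s) (x - y)) := fun x =>
      (integrable_gradKernel hpos).comp_sub_left x
    simp only [duhamelIntegrand]
    rw [← integral_sub (integrable_gradKernel_apply hpos hWm hb1 x)
      (integrable_gradKernel_apply hpos hWm hb1 z)]
    calc ‖∫ y, (gradKernel (t - s) (x - y) (W s y) - gradKernel (t - s) (z - y) (W s y))‖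
        ≤ ∫ y, ‖gradKernel (t - s) (x - y) - gradKernel (t - s) (z - y)‖ * b := by
          refine norm_integral_le_of_norm_le (((hkx x).sub (hkx z)).norm.mul_const b) ?_
          filter_upwards [hb1] with y hy
          rw [← sub_apply]
          exact (ContinuousLinearMap.le_opNorm _ _).trans (by gcongr)
      _ = (∫ y, ‖gradKernel (t - s) (y + (x - z)) - gradKernel (t - s) y‖) * b := by
          rw [integral_mul_const, ← integral_sub_left_eq_self
            (fun y => ‖gradKernel (t - s) (y + (x - z)) - gradKernel (t - s) y‖) volume z]
          congr 2 with y
          congr 3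
          abel
      _ ≤ (N * invScale (t - s) ^ 2 * ‖x - z‖) * b := by
          gcongr
          exact H _ hpos _
      _ = N * ‖x - z‖ * ((t - s) ^ (-(1 / 2 : ℝ)) * b) := by rw [invScale_sq hpos.le]; ring
      _ ≤ _ := by gcongr
  rw [dist_eq_norm, dist_eq_norm]
  refine hmain.trans ?_
  rw [intervalIntegral.integral_const_mul]
  calc N * ‖x - z‖ * ∫ s in (0 : ℝ)..t, m s = (N * ∫ s in (0 : ℝ)..t, m s) * ‖x - z‖ := by ring
    _ ≤ _ := by
      gcongr
      exact Real.le_coe_toNNReal _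

end Duhamel

/-! ### Contraction for the difference of the gradients -/

section Uniqueness

variable {n : ℕ}

lemma rpow_neg_quarter_pow {s : ℝ} (hs : 0 ≤ s) (k : ℕ) :
    (s ^ (-(1 : ℝ) / 4)) ^ k = s ^ (-((k : ℝ) / 4)) := by
  rw [← Real.rpow_natCast, ← Real.rpow_mul hs]; ring_nf

/-- `F` grows at most cubically and `|∇u| ≤ K s^(-1/4)`; lower powers of `s^(-1/4)` are absorbed
into the cube because `s^(-1/4) ≥ T^(-1/4)`. -/
lemma IsWeakJet.isFlux {T : ℝ} (hT : 0 < T) {u : ℝ → Rn n → ℝ} {Du : ℝ → Rn n → Rn n}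
    {D2u : ℝ → Rn n → Rn n →L[ℝ] Rn n} (hj : IsWeakJet T u Du D2u) {F : Rn n → Rn n}
    (hF : ContDiff ℝ 1 F) {C : ℝ} (hC : 0 < C)
    (hlip : ∀ ξ₁ ξ₂ : Rn n,
      ‖fderiv ℝ F ξ₁ - fderiv ℝ F ξ₂‖ ≤ C * (‖ξ₁‖ + ‖ξ₂‖) * ‖ξ₁ - ξ₂‖)
    {K : ℝ} (hK : 0 ≤ K) (hb : ∀ t ∈ Ioc 0 T, ∀ᵐ x, ‖Du t x‖ ≤ K * t ^ (-(1 : ℝ) / 4)) :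
    ∃ M, IsFlux T M (fun s y => F (Du s y)) := by
  set A := ‖fderiv ℝ F 0‖
  set p₀ := T ^ (-(1 : ℝ) / 4)
  have hp₀ : 0 < p₀ := Real.rpow_pos_of_pos hT _
  refine ⟨‖F 0‖ / p₀ ^ 3 + A * K / p₀ ^ 2 + C * K ^ 3,
    hF.continuous.comp_aestronglyMeasurable hj.aesm_grad, fun s hs =>
    hF.continuous.comp_aestronglyMeasurable (hj.weak_hess s hs).1.aestronglyMeasurable,
    fun s hs => ?_⟩
  filter_upwards [hb s hs] with y hy
  set p := s ^ (-(1 : ℝ) / 4) with hp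
  have hpp : p₀ ≤ p := Real.rpow_le_rpow_of_nonpos hs.1 hs.2 (by norm_num)
  have hp3 : s ^ (-(3 / 4 : ℝ)) = p ^ 3 := by
    rw [hp, rpow_neg_quarter_pow hs.1.le]; norm_num
  have hp0 : 0 < p := hp₀.trans_le hpp
  have h1 := norm_flux_sub_le hF hC hlip hy (ξ₂ := 0) (by simpa using by positivity)
  rw [sub_zero] at h1
  have h2 := norm_le_norm_add_norm_sub' (F (Du s y)) (F 0)
  have h3 : ‖F 0‖ ≤ ‖F 0‖ / p₀ ^ 3 * p ^ 3 := by
    rw [div_mul_eq_mul_div, le_div_iff₀ (by positivity)]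
    gcongr
  have h4 : A * K * p ≤ A * K / p₀ ^ 2 * p ^ 3 := by
    rw [div_mul_eq_mul_div, le_div_iff₀ (by positivity)]
    calc A * K * p * p₀ ^ 2 ≤ A * K * p * p ^ 2 := by gcongr
      _ = _ := by ring
  have h5 : (A + C * (K * p) ^ 2) * ‖Du s y‖ ≤ (A + C * (K * p) ^ 2) * (K * p) := by gcongr
  rw [hp3]
  calc ‖F (Du s y)‖ ≤ ‖F 0‖ + (A + C * (K * p) ^ 2) * (K * p) := by linarith
    _ = ‖F 0‖ + A * K * p + C * K ^ 3 * p ^ 3 := by ring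
    _ ≤ ‖F 0‖ / p₀ ^ 3 * p ^ 3 + A * K / p₀ ^ 2 * p ^ 3 + C * K ^ 3 * p ^ 3 := by gcongr
    _ = _ := by ring

/-- The Duhamel term of a mild solution in divergence form. -/
lemma IsWeakJet.integral_semigroup_eq_duhamel {T : ℝ} {u : ℝ → Rn n → ℝ} {Du : ℝ → Rn n → Rn n}
    {D2u : ℝ → Rn n → Rn n →L[ℝ] Rn n} (hj : IsWeakJet T u Du D2u) {F : Rn n → Rn n}
    (hF : ContDiff ℝ 1 F)
    (hb : ∀ t ∈ Ioc 0 T, (∃ B : ℝ, ∀ᵐ x, ‖Du t x‖ ≤ B) ∧ ∃ L : ℝ≥0, ∀ᵐ x, ‖D2u t x‖ ≤ L)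
    {t : ℝ} (ht : t ∈ Ioc 0 T) (x : Rn n) :
    ∫ s in (0 : ℝ)..t, semigroup (t - s) (fun y => divFlux F (Du s y) (D2u s y)) x =
      duhamel (fun s y => F (Du s y)) t x := by
  rw [duhamel, intervalIntegral.integral_of_le ht.1.le, intervalIntegral.integral_of_le ht.1.le,
    integral_Ioc_eq_integral_Ioo, integral_Ioc_eq_integral_Ioo]
  refine setIntegral_congr_fun measurableSet_Ioo fun s hs => ?_
  have hsT : s ∈ Ioc 0 T := ⟨hs.1, hs.2.le.trans ht.2⟩
  obtain ⟨⟨B, hB⟩, L, hL⟩ := hb s hsT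
  exact semigroup_divFlux_eq hF (hj.weak_hess s hsT) hB hL (sub_pos.2 hs.2) x

/-- The exponential weight buys the small factor `μ⁻¹` at the price of a worse, still integrable
singularity: with `x = μ (t-s)^(1/4)` this is `x ≤ 1 + x⁴ ≤ exp(x⁴)`. The fourth power of `μ`
matches the parabolic scaling. -/
lemma exp_mul_rpow_le {μ : ℝ} (hμ : 0 < μ) {s t : ℝ} (hst : s < t) :
    Real.exp (μ ^ 4 * s) * (t - s) ^ (-(1 / 2 : ℝ)) ≤
      Real.exp (μ ^ 4 * t) * (μ⁻¹ * (t - s) ^ (-(3 / 4 : ℝ))) := by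
  have hr : 0 < t - s := sub_pos.2 hst
  set r := t - s with hr'
  set q := r ^ (1 / 4 : ℝ) with hq
  have hq0 : 0 < q := Real.rpow_pos_of_pos hr _
  have hq4 : q ^ 4 = r := by
    rw [hq, ← Real.rpow_natCast, ← Real.rpow_mul hr.le]; norm_num
  have h1 : r ^ (-(1 / 2 : ℝ)) = r ^ (-(3 / 4 : ℝ)) * q := by
    rw [hq, ← Real.rpow_add hr]; norm_num
  have h2 : μ * q ≤ Real.exp (μ ^ 4 * r) := by
    have h3 := Real.add_one_le_exp (μ ^ 4 * r)
    have h4 : μ ^ 4 * r = (μ * q) ^ 4 := by rw [mul_pow, hq4]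
    have h5 : μ * q ≤ (μ * q) ^ 4 + 1 := by
      nlinarith [sq_nonneg ((μ * q) ^ 2 - 1), sq_nonneg (μ * q - 1), sq_nonneg (μ * q)]
    linarith
  have h6 : Real.exp (μ ^ 4 * t) = Real.exp (μ ^ 4 * s) * Real.exp (μ ^ 4 * r) := by
    rw [← Real.exp_add, hr']; ring_nf
  rw [h6, h1]
  calc Real.exp (μ ^ 4 * s) * (r ^ (-(3 / 4 : ℝ)) * q)
      = Real.exp (μ ^ 4 * s) * (μ * q) * (μ⁻¹ * r ^ (-(3 / 4 : ℝ))) := by field_simp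
    _ ≤ Real.exp (μ ^ 4 * s) * Real.exp (μ ^ 4 * r) * (μ⁻¹ * r ^ (-(3 / 4 : ℝ))) := by
        gcongr
    _ = _ := by ring

/-- The integral inequality satisfied by the difference of the gradients of two solutions is
contractive in a weighted norm. -/
lemma integral_weight_le {N E K' W μ t T : ℝ} (hN : 0 ≤ N) (hK' : 0 ≤ K')
    (hW : 0 ≤ W) (hμ : 0 < μ) (ht : t ∈ Ioc 0 T)
    (h1 : N * E * betaConst (1 / 2) (3 / 4) ≤ 1 / 4)
    (h2 : N * K' * betaConst (3 / 4) (1 / 4) * T ^ (1 / 4 : ℝ) * μ⁻¹ ≤ 1 / 4) :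
    N * ∫ s in (0 : ℝ)..t, W * Real.exp (μ ^ 4 * t) *
      (E * ((t - s) ^ (-(1 / 2 : ℝ)) * s ^ (-(3 / 4 : ℝ))) +
        K' * μ⁻¹ * ((t - s) ^ (-(3 / 4 : ℝ)) * s ^ (-(1 / 4 : ℝ)))) ≤
      W / 2 * Real.exp (μ ^ 4 * t) * t ^ (-(1 : ℝ) / 4) := by
  have i1 := intervalIntegrable_sub_rpow_mul_rpow (a := 1 / 2) (b := 3 / 4) (by norm_num)
    (by norm_num) ht.1
  have i2 := intervalIntegrable_sub_rpow_mul_rpow (a := 3 / 4) (b := 1 / 4) (by norm_num)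
    (by norm_num) ht.1
  rw [intervalIntegral.integral_const_mul, intervalIntegral.integral_add (i1.const_mul _)
    (i2.const_mul _), intervalIntegral.integral_const_mul, intervalIntegral.integral_const_mul,
    integral_sub_rpow_mul_rpow _ _ ht.1, integral_sub_rpow_mul_rpow _ _ ht.1]
  set P := t ^ (-(1 : ℝ) / 4) with hP
  have hP0 : 0 < P := Real.rpow_pos_of_pos ht.1 _
  -- The first term reproduces `t^(-1/4)` exactly, so only the small `E` can help; the second leaves
  -- a spare `t^(1/4) ≤ T^(1/4)`.
  have e1 : t ^ (1 - 1 / 2 - 3 / 4 : ℝ) = P := by rw [hP]; norm_num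
  have e2 : t ^ (1 - 3 / 4 - 1 / 4 : ℝ) ≤ T ^ (1 / 4 : ℝ) * P := by
    have : t ^ (1 - 3 / 4 - 1 / 4 : ℝ) = t ^ (1 / 4 : ℝ) * P := by
      rw [hP, ← Real.rpow_add ht.1]; norm_num
    rw [this]
    gcongr
    · exact ht.1.le
    · exact ht.2
  have hB2 := betaConst_nonneg (3 / 4) (1 / 4)
  rw [e1]
  set B1 := betaConst (1 / 2) (3 / 4)
  set B2 := betaConst (3 / 4) (1 / 4)
  calc N * (W * Real.exp (μ ^ 4 * t) *
        (E * (B1 * P) + K' * μ⁻¹ * (B2 * t ^ (1 - 3 / 4 - 1 / 4 : ℝ))))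
      ≤ N * (W * Real.exp (μ ^ 4 * t) *
        (E * (B1 * P) + K' * μ⁻¹ * (B2 * (T ^ (1 / 4 : ℝ) * P)))) := by gcongr
    _ = W * Real.exp (μ ^ 4 * t) * P *
        (N * E * B1 + N * K' * B2 * T ^ (1 / 4 : ℝ) * μ⁻¹) := by ring
    _ ≤ W * Real.exp (μ ^ 4 * t) * P * (1 / 4 + 1 / 4) := by gcongr
    _ = _ := by ring

/-- The gradients of two mild solutions in `X_{0,T}` whose initial data differ by a constant
coincide. -/
theorem grad_ae_eq_of_sub_eq_duhamel {F : Rn n → Rn n} (hF : ContDiff ℝ 1 F) {C : ℝ} (hC : 0 < C)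
    (hlip : ∀ ξ₁ ξ₂ : Rn n,
      ‖fderiv ℝ F ξ₁ - fderiv ℝ F ξ₂‖ ≤ C * (‖ξ₁‖ + ‖ξ₂‖) * ‖ξ₁ - ξ₂‖)
    {T : ℝ} (hT : 0 < T) {u v : ℝ → Rn n → ℝ} {Du Dv : ℝ → Rn n → Rn n}
    {D2u D2v : ℝ → Rn n → Rn n →L[ℝ] Rn n} (hju : IsWeakJet T u Du D2u)
    (hjv : IsWeakJet T v Dv D2v)
    {K : ℝ} (hK : 0 ≤ K)
    (hbu : ∀ t ∈ Ioc 0 T, ∀ᵐ x, ‖Du t x‖ ≤ K * t ^ (-(1 : ℝ) / 4))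
    (hbv : ∀ t ∈ Ioc 0 T, ∀ᵐ x, ‖Dv t x‖ ≤ K * t ^ (-(1 : ℝ) / 4))
    (hsmall : ∀ η : ℝ, 0 < η → ∃ t₀ ∈ Ioc 0 T, ∀ t ∈ Ioc 0 t₀,
      ∀ᵐ x, ‖Du t x‖ ≤ η * t ^ (-(1 : ℝ) / 4) ∧ ‖Dv t x‖ ≤ η * t ^ (-(1 : ℝ) / 4))
    {c : ℝ} (hw : ∀ t ∈ Ioc 0 T, ∀ᵐ x, u t x - v t x =
      c + duhamel (fun s y => F (Du s y) - F (Dv s y)) t x) :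
    ∀ t ∈ Ioc 0 T, Du t =ᵐ[volume] Dv t := by
  obtain ⟨N, hN, hNL⟩ := exists_duhamel_lipschitzWith n
  obtain ⟨M, hGu⟩ := hju.isFlux hT hF hC hlip hK hbu
  obtain ⟨M', hGv⟩ := hjv.isFlux hT hF hC hlip hK hbv
  set B1 := betaConst (1 / 2) (3 / 4) with hB1
  set B2 := betaConst (3 / 4) (1 / 4) with hB2
  have hB1' : 0 ≤ B1 := betaConst_nonneg _ _
  have hB2' : 0 ≤ B2 := betaConst_nonneg _ _
  set A := ‖fderiv ℝ F 0‖
  set Q := N * C * B1 with hQ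
  have hQ0 : 0 ≤ Q := by positivity
  -- Chosen so that `Q η² ≤ 1/4`; likewise `μ` below gives `R/μ ≤ 1/4`. Together they produce the
  -- contraction factor `1/2`.
  set η := (2 * (Q + 1))⁻¹ with hη
  have hη0 : 0 < η := by positivity
  have hc1 : N * (C * η ^ 2) * B1 ≤ 1 / 4 := by
    have : N * (C * η ^ 2) * B1 = Q * η ^ 2 := by rw [hQ]; ring
    rw [this, hη, inv_pow, ← div_eq_mul_inv, div_le_div_iff₀ (by positivity) (by norm_num)]
    nlinarith
  obtain ⟨t₀, ht₀, hs⟩ := hsmall η hη0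
  set K' := A + C * (K * t₀ ^ (-(1 : ℝ) / 4)) ^ 2 with hK'
  have hK'0 : 0 ≤ K' := by positivity
  set R := N * K' * B2 * T ^ (1 / 4 : ℝ) with hR
  have hR0 : 0 ≤ R := by positivity
  set μ := 4 * (R + 1) with hμ
  have hμ0 : 0 < μ := by positivity
  have hc2 : R * μ⁻¹ ≤ 1 / 4 := by
    rw [hμ, ← div_eq_mul_inv, div_le_div_iff₀ (by positivity) (by norm_num)]
    linarith
  -- Up to `t₀` the quadratic part of the Lipschitz constant is singular but small; after `t₀` it is
  -- bounded and goes into `K'`, together with `|F'(0)|`.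
  have hpair : ∀ s ∈ Ioc 0 T, ∀ᵐ y, ‖F (Du s y) - F (Dv s y)‖ ≤
      (C * η ^ 2 * s ^ (-(1 / 2 : ℝ)) + K') * ‖Du s y - Dv s y‖ := by
    intro s hsT
    have hp2 : (s ^ (-(1 : ℝ) / 4)) ^ 2 = s ^ (-(1 / 2 : ℝ)) := by
      rw [rpow_neg_quarter_pow hsT.1.le]; norm_num
    have hp2' : 0 ≤ s ^ (-(1 / 2 : ℝ)) := Real.rpow_nonneg hsT.1.le _
    rcases le_or_gt s t₀ with hst | hst
    · filter_upwards [hs s ⟨hsT.1, hst⟩] with y hy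
      refine (norm_flux_sub_le hF hC hlip hy.1 hy.2).trans ?_
      rw [mul_pow, hp2]
      have : 0 ≤ C * (K * t₀ ^ (-(1 : ℝ) / 4)) ^ 2 := by positivity
      refine mul_le_mul_of_nonneg_right ?_ (norm_nonneg _)
      rw [hK']
      linarith
    · filter_upwards [hbu s hsT, hbv s hsT] with y h1 h2
      have hle : K * s ^ (-(1 : ℝ) / 4) ≤ K * t₀ ^ (-(1 : ℝ) / 4) :=
        mul_le_mul_of_nonneg_left
          (Real.rpow_le_rpow_of_nonpos ht₀.1 hst.le (by norm_num)) hK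
      refine (norm_flux_sub_le hF hC hlip (h1.trans hle) (h2.trans hle)).trans ?_
      have : 0 ≤ C * η ^ 2 * s ^ (-(1 / 2 : ℝ)) := by positivity
      refine mul_le_mul_of_nonneg_right ?_ (norm_nonneg _)
      linarith
  have hhalf : ∀ W : ℝ, 0 ≤ W →
      (∀ s ∈ Ioc 0 T, ∀ᵐ y, ‖Du s y - Dv s y‖ ≤
        W * Real.exp (μ ^ 4 * s) * s ^ (-(1 : ℝ) / 4)) →
      ∀ t ∈ Ioc 0 T, ∀ᵐ y, ‖Du t y - Dv t y‖ ≤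
        W / 2 * Real.exp (μ ^ 4 * t) * t ^ (-(1 : ℝ) / 4) := by
    intro W hW hWb t ht
    set m : ℝ → ℝ := fun s => W * Real.exp (μ ^ 4 * t) *
      (C * η ^ 2 * ((t - s) ^ (-(1 / 2 : ℝ)) * s ^ (-(3 / 4 : ℝ))) +
        K' * μ⁻¹ * ((t - s) ^ (-(3 / 4 : ℝ)) * s ^ (-(1 / 4 : ℝ)))) with hm
    have hmi : IntervalIntegrable m volume 0 t :=
      (((intervalIntegrable_sub_rpow_mul_rpow (by norm_num) (by norm_num) ht.1).const_mul _).add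
        ((intervalIntegrable_sub_rpow_mul_rpow (by norm_num) (by norm_num)
          ht.1).const_mul _)).const_mul _
    have hL := hNL T (max M M') (fun s y => F (Du s y)) (fun s y => F (Dv s y))
      (hGu.mono (le_max_left _ _)) (hGv.mono (le_max_right _ _)) t ht m hmi fun s hst => by
        have hsT : s ∈ Ioc 0 T := ⟨hst.1, hst.2.le.trans ht.2⟩
        refine ⟨(C * η ^ 2 * s ^ (-(1 / 2 : ℝ)) + K') *
          (W * Real.exp (μ ^ 4 * s) * s ^ (-(1 : ℝ) / 4)), ?_, ?_⟩
        · have hp2' : 0 ≤ s ^ (-(1 / 2 : ℝ)) := Real.rpow_nonneg hsT.1.le _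
          filter_upwards [hpair s hsT, hWb s hsT] with y h1 h2
          exact h1.trans (by gcongr)
        · have hr : 0 < t - s := sub_pos.2 hst.2
          have e1 : s ^ (-(1 / 2 : ℝ)) * s ^ (-(1 : ℝ) / 4) = s ^ (-(3 / 4 : ℝ)) := by
            rw [← Real.rpow_add hst.1]; norm_num
          have e2 : s ^ (-(1 : ℝ) / 4) = s ^ (-(1 / 4 : ℝ)) := by norm_num
          have hp : 0 ≤ s ^ (-(1 / 4 : ℝ)) := Real.rpow_nonneg hsT.1.le _
          have hp' : 0 ≤ s ^ (-(3 / 4 : ℝ)) := Real.rpow_nonneg hsT.1.le _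
          have hr' : 0 ≤ (t - s) ^ (-(1 / 2 : ℝ)) := Real.rpow_nonneg hr.le _
          have he : Real.exp (μ ^ 4 * s) ≤ Real.exp (μ ^ 4 * t) := by
            gcongr; exact hst.2.le
          calc (t - s) ^ (-(1 / 2 : ℝ)) * ((C * η ^ 2 * s ^ (-(1 / 2 : ℝ)) + K') *
                (W * Real.exp (μ ^ 4 * s) * s ^ (-(1 : ℝ) / 4)))
              = W * (C * η ^ 2) * (t - s) ^ (-(1 / 2 : ℝ)) *
                  (s ^ (-(1 / 2 : ℝ)) * s ^ (-(1 : ℝ) / 4)) * Real.exp (μ ^ 4 * s) +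
                W * K' * s ^ (-(1 : ℝ) / 4) *
                  (Real.exp (μ ^ 4 * s) * (t - s) ^ (-(1 / 2 : ℝ))) := by ring
            _ ≤ W * (C * η ^ 2) * (t - s) ^ (-(1 / 2 : ℝ)) *
                  s ^ (-(3 / 4 : ℝ)) * Real.exp (μ ^ 4 * t) +
                W * K' * s ^ (-(1 / 4 : ℝ)) *
                  (Real.exp (μ ^ 4 * t) * (μ⁻¹ * (t - s) ^ (-(3 / 4 : ℝ)))) := by
                rw [e1, e2]
                have := exp_mul_rpow_le hμ0 hst.2
                gcongr
            _ = m s := by rw [hm]; ring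
    have hlipΨ : LipschitzWith (N * ∫ s in (0 : ℝ)..t, m s).toNNReal
        (fun x => c + duhamel (fun s y => F (Du s y) - F (Dv s y)) t x) :=
      LipschitzWith.of_dist_le_mul fun x y => by
        rw [dist_add_left]; exact hL.dist_le_mul x y
    have hwd : HasWeakFDeriv (fun x => u t x - v t x)
        (fun x => innerSL ℝ (Du t x - Dv t x)) := by
      have := (hju.weak_grad t ht).sub (hjv.weak_grad t ht)
      simpa only [map_sub] using this
    have hbound : N * ∫ s in (0 : ℝ)..t, m s ≤
        W / 2 * Real.exp (μ ^ 4 * t) * t ^ (-(1 : ℝ) / 4) :=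
      integral_weight_le hN hK'0 hW hμ0 ht hc1 hc2
    filter_upwards [norm_weakGrad_le_of_lipschitzWith hwd (hw t ht) hlipΨ] with y hy
    have hnn : 0 ≤ W / 2 * Real.exp (μ ^ 4 * t) * t ^ (-(1 : ℝ) / 4) := by
      have := Real.rpow_nonneg ht.1.le (-(1 : ℝ) / 4)
      positivity
    exact hy.trans (by rw [Real.coe_toNNReal']; exact max_le hbound hnn)
  clear_value μ
  -- The a priori gradient bounds start the iteration at `W = 2K`, the weight being at least `1`.
  have hiter : ∀ k : ℕ, ∀ t ∈ Ioc 0 T, ∀ᵐ y, ‖Du t y - Dv t y‖ ≤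
      2 * K / 2 ^ k * Real.exp (μ ^ 4 * t) * t ^ (-(1 : ℝ) / 4) := by
    intro k
    induction k with
    | zero =>
      intro t ht
      filter_upwards [hbu t ht, hbv t ht] with y h1 h2
      have hp := Real.rpow_nonneg ht.1.le (-(1 : ℝ) / 4)
      have he : 1 ≤ Real.exp (μ ^ 4 * t) :=
        Real.one_le_exp (mul_nonneg (by positivity) ht.1.le)
      calc ‖Du t y - Dv t y‖ ≤ 2 * K * 1 * t ^ (-(1 : ℝ) / 4) := by
            have := norm_sub_le (Du t y) (Dv t y); linarith
        _ ≤ 2 * K / 2 ^ 0 * Real.exp (μ ^ 4 * t) * t ^ (-(1 : ℝ) / 4) := by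
            rw [pow_zero, div_one]; gcongr
    | succ k ih =>
      have := hhalf _ (by positivity) ih
      simpa only [pow_succ, div_div] using this
  intro t ht
  filter_upwards [ae_all_iff.2 fun k => hiter k t ht] with y hy
  have hK2 : Tendsto (fun k : ℕ => 2 * K / 2 ^ k) atTop (𝓝 0) :=
    tendsto_const_nhds.div_atTop (tendsto_pow_atTop_atTop_of_one_lt one_lt_two)
  have hlim : Tendsto (fun k : ℕ => 2 * K / 2 ^ k * Real.exp (μ ^ 4 * t) * t ^ (-(1 : ℝ) / 4))
      atTop (𝓝 (0 * Real.exp (μ ^ 4 * t) * t ^ (-(1 : ℝ) / 4))) :=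
    (hK2.mul_const _).mul_const _
  have h0 := ge_of_tendsto' hlim hy
  rw [zero_mul, zero_mul] at h0
  exact sub_eq_zero.1 (norm_le_zero_iff.1 h0)

/-- It suffices that directional derivatives of test functions have integral zero, which is the
scalar case for the constant `1`. -/
lemma hasWeakFDeriv_const {G : Type*} [NormedAddCommGroup G] [NormedSpace ℝ G] [CompleteSpace G]
    (a : G) : HasWeakFDeriv (fun _ : Rn n => a) (fun _ => 0) := by
  refine ⟨locallyIntegrable_const a, locallyIntegrable_const _, fun φ hφ hc e => ?_⟩
  have h := (LipschitzWith.const (α := Rn n) (1 : ℝ)).hasWeakFDeriv.2.2 φ hφ hc e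
  simp only [fderiv_fun_const, Pi.zero_apply, zero_apply, smul_eq_mul, mul_one,
    mul_zero, integral_zero, neg_zero] at h
  simp only [zero_apply, smul_zero, integral_zero, neg_zero]
  rw [integral_smul_const, h, zero_smul]

/-- A function which is spatially constant has vanishing norm in `X_T`. -/
lemma XNorm_eq_zero_of_ae_eq_const {T : ℝ} {w : ℝ → Rn n → ℝ} {c : ℝ}
    (hm : AEStronglyMeasurable (fun p : ℝ × Rn n => w p.1 p.2)
      ((volume.restrict (Ioc 0 T)).prod volume))
    (hw : ∀ t ∈ Ioc 0 T, ∀ᵐ x, w t x = c) : XNorm T w = 0 := by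
  have hj : IsWeakJet T w (fun _ _ => 0) (fun _ _ => 0) := by
    refine ⟨hm, aestronglyMeasurable_const, aestronglyMeasurable_const, fun t ht => ?_,
      fun t _ => hasWeakFDeriv_const 0⟩
    have h1 : (fun _ => c) =ᵐ[volume] w t := by
      filter_upwards [hw t ht] with x hx using hx.symm
    obtain ⟨h2, h3, h4⟩ := hasWeakFDeriv_const (n := n) c
    simp only [map_zero]
    refine ⟨h2.congr h1, h3, fun φ hφ hc e => ?_⟩
    rw [← h4 φ hφ hc e]
    refine integral_congr_ae ?_
    filter_upwards [h1] with x hx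
    rw [hx]
  refine le_antisymm ?_ bot_le
  rw [XNorm]
  refine (iInf₂_le_of_le _ _ (iInf_le _ hj)).trans (le_of_eq ?_)
  have h1 : ∀ {G : Type} [NormedAddCommGroup G] (k : ℕ),
      Ninfty (n := n) k T (fun _ _ => (0 : G)) = 0 := by
    intro G _ k
    simp only [Ninfty, eLpNorm_zero', mul_zero, ENNReal.iSup_zero]
  -- For `k = 0` the exponent `4 / k` would be `0`, and `0 ^ 0 = 1`.
  have h2 : ∀ {G : Type} [NormedAddCommGroup G] (k : ℕ), 0 < k →
      Ncarleson (n := n) k T (fun _ _ => (0 : G)) = 0 := by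
    intro G _ k hk
    have hk' : 0 < (k : ℝ) := by exact_mod_cast hk
    simp only [Ncarleson, enorm_zero, ENNReal.zero_rpow_of_pos (div_pos four_pos hk'),
      laverage_zero, lintegral_zero, ENNReal.zero_rpow_of_pos (div_pos hk' four_pos),
      ENNReal.iSup_zero]
  rw [h1, h1, h2 1 one_pos, h2 2 two_pos]
  simp

end Uniqueness

end BiharmonicBMO

end

/-! ### Conclusion: from equal gradients to a constant difference -/

theorem mainTheorem3 (n : ℕ) (F : BiharmonicBMO.Rn n → BiharmonicBMO.Rn n)
    (hF : ContDiff ℝ 1 F)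
    (hlip : ∃ C : ℝ, 0 < C ∧ ∀ ξ₁ ξ₂ : BiharmonicBMO.Rn n,
      ‖fderiv ℝ F ξ₁ - fderiv ℝ F ξ₂‖ ≤ C * (‖ξ₁‖ + ‖ξ₂‖) * ‖ξ₁ - ξ₂‖)
    (T : ℝ) (hT : 0 < T)
    (u₀ v₀ : BiharmonicBMO.Rn n → ℝ) (hu₀ : BiharmonicBMO.MemBMO u₀)
    (c : ℝ) (huv₀ : ∀ᵐ x, u₀ x - v₀ x = c)
    (u v : ℝ → BiharmonicBMO.Rn n → ℝ)
    (hu : BiharmonicBMO.MemX0 T u) (hv : BiharmonicBMO.MemX0 T v)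
    (hmu : BiharmonicBMO.IsMildSolution F T u₀ u)
    (hmv : BiharmonicBMO.IsMildSolution F T v₀ v) :
    (∀ t ∈ Icc 0 T, ∀ᵐ x, u t x - v t x = c) ∧
      BiharmonicBMO.XNorm T (fun t x => u t x - v t x) = 0 := by
  obtain ⟨C, hC, hlip⟩ := hlip
  obtain ⟨hu0, Du, D2u, hju, hdu⟩ := hmu
  obtain ⟨hv0, Dv, D2v, hjv, hdv⟩ := hmv
  obtain ⟨Ku, hKu⟩ := ENNReal.lt_iff_exists_nnreal_btwn.1 hu.1
  obtain ⟨Kv, hKv⟩ := ENNReal.lt_iff_exists_nnreal_btwn.1 hv.1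
  set K : NNReal := max Ku Kv
  have hbu := fun t ht => hju.ae_le_of_XNorm_lt le_rfl
    (hKu.1.trans_le (ENNReal.coe_le_coe.2 (le_max_left Ku Kv))) (t := t) ht
  have hbv := fun t ht => hjv.ae_le_of_XNorm_lt le_rfl
    (hKv.1.trans_le (ENNReal.coe_le_coe.2 (le_max_right Ku Kv))) (t := t) ht
  have hsmall : ∀ η : ℝ, 0 < η → ∃ t₀ ∈ Ioc 0 T, ∀ t ∈ Ioc 0 t₀,
      ∀ᵐ x, ‖Du t x‖ ≤ η * t ^ (-(1 : ℝ) / 4) ∧ ‖Dv t x‖ ≤ η * t ^ (-(1 : ℝ) / 4) := by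
    intro η hη
    lift η to NNReal using hη.le
    have hη' : (0 : ℝ≥0∞) < η := by exact_mod_cast hη
    -- One time `t₀ ≤ T` at which both norms are below `η`; it controls all earlier times as well,
    -- the norm involving a supremum over `(0,t₀]`.
    obtain ⟨t₀, ⟨h1, h2⟩, h3⟩ := ((hu.2.eventually_lt_const hη').and
      (hv.2.eventually_lt_const hη')).and (Ioc_mem_nhdsGT hT) |>.exists
    refine ⟨t₀, h3, fun t ht => ?_⟩
    exact (hju.ae_le_of_XNorm_lt h3.2 h1 ht).1.and (hjv.ae_le_of_XNorm_lt h3.2 h2 ht).1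
  obtain ⟨M, hGu⟩ := hju.isFlux hT hF hC hlip K.coe_nonneg fun t ht => (hbu t ht).1
  obtain ⟨M', hGv⟩ := hjv.isFlux hT hF hC hlip K.coe_nonneg fun t ht => (hbv t ht).1
  have hw : ∀ t ∈ Ioc 0 T, ∀ᵐ x, u t x - v t x =
      c + BiharmonicBMO.duhamel (fun s y => F (Du s y) - F (Dv s y)) t x := by
    intro t ht
    filter_upwards [hdu t ht, hdv t ht] with x hx hy
    rw [hx, hy, hju.integral_semigroup_eq_duhamel hF
        (fun t ht => ⟨⟨_, (hbu t ht).1⟩, (hbu t ht).2⟩) ht x,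
      hjv.integral_semigroup_eq_duhamel hF
        (fun t ht => ⟨⟨_, (hbv t ht).1⟩, (hbv t ht).2⟩) ht x,
      ← BiharmonicBMO.duhamel_sub hGu hGv ht x,
      ← BiharmonicBMO.semigroup_sub_semigroup_eq_const ht.1 hu₀ huv₀ x]
    ring
  have hgrad := BiharmonicBMO.grad_ae_eq_of_sub_eq_duhamel hF hC hlip hT hju hjv K.coe_nonneg
    (fun t ht => (hbu t ht).1) (fun t ht => (hbv t ht).1) hsmall hw
  have hconst : ∀ t ∈ Ioc 0 T, ∀ᵐ x, u t x - v t x = c := by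
    intro t ht
    filter_upwards [hw t ht] with x hx
    rw [hx, BiharmonicBMO.duhamel_eq_zero ht.1 (fun s hs => ?_), add_zero]
    filter_upwards [hgrad s ⟨hs.1, hs.2.le.trans ht.2⟩] with y hy
    rw [hy, sub_self]
  refine ⟨fun t ht => ?_, BiharmonicBMO.XNorm_eq_zero_of_ae_eq_const
    (hju.aesm.sub hjv.aesm) hconst⟩
  -- At `t = 0` the Duhamel formula is not available and the initial conditions are used instead.
  rcases ht.1.eq_or_lt with h0 | h0
  · subst h0
    filter_upwards [hu0, hv0, huv₀] with x h1 h2 h3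
    rw [h1, h2, h3]
  · exact hconst t ⟨h0, ht.2⟩
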